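/- **Setting.** Let $\mathrm K=\mathrm{diag}(1,1,-1)$ and $\langle u,v\rangle_{\mathrm K}=(u,\mathrm K v)$ on $\mathbb R^3$, where $(\cdot,\cdot)$ is the Euclidean scalar product. The Lobachevsky plane is $L^2=\{(X,Y,Z)\in\mathbb R^3: X^2+Y^2-Z^2=-1,\ Z>0\}$ with the Riemannian metric induced by $\langle\cdot,\cdot\rangle_{\mathrm K}$. Let $SO(2,1)$ denote the group of its orientation preserving isometries, i.e. the real $3\times3$ matrices $g$ with $g^T\mathrm K g=\mathrm K$ and $\det g=1$ that map $L^2$ to itself. Let $so(2,1)=\{\xi:\xi^T\mathrm K+\mathrm K\xi=0\}$ be its Lie algebra, with the commutator, identified with $\mathbb R^3$ by $\omega\mapsto\widehat\omega\,\mathrm K$, where $\widehat\omega v=\omega\times v$. Let $Q=(L^2\times L^2)\setminus\Delta$, where $\Delta$ is the diagonal (the collision set), let $T^*Q$ carry its canonical Poisson bracket (positions $x_i$ and conjugate momenta $\xi_j$ satisfy $\{x_i,\xi_j\}=\delta_{ij}$), and let $SO(2,1)$ act on $T^*Q$ by the cotangent lift of the diagonal action on $Q$. For masses $\mu_1,\mu_2>0$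 and a potential $U:(0,\infty)\to\mathbb R$, let $H=T+U$ on $T^*Q$, where $T$ is the kinetic energy (the Legendre transform of $\frac12\sum_\alpha\mu_\alpha\langle v_\alpha,v_\alpha\rangle_{\mathrm K}$) and $U$ is evaluated at the Riemannian distance of the two bodies. **Theorem.** 1. The relations $$\{m_x,m_y\}=m_z,\quad \{m_y,m_z\}=-m_x,\quad \{m_z,m_x\}=-m_y,\quad \{q,p\}=1,$$ with all the other brackets of coordinate functions equal to zero, define a Poisson bracket on the smooth functions on $\mathbb R^3\times(0,\infty)\times\mathbb R\ni(\boldsymbol m,q,p)$, $\boldsymbol m=(m_x,m_y,m_z)^T$. It is the product of the Lie–Poisson bracket $\{f,g\}(\boldsymbol m)=-(\boldsymbol m,[\nabla f,\nabla g]_{so(2,1)})$ on $so(2,1)^*\cong\mathbb R^3$ and the canonical bracket of $(q,p)$. 2. The reduced space $T^*Q/SO(2,1)$ is isomorphic, as a Poisson manifold, to $\mathbb R^3\times(0,\infty)\times\mathbb R$ with this bracket: there is a homeomorphism $\Phi:T^*Q/SO(2,1)\to\mathbb R^3\times(0,\infty)\times\mathbb R$ whose composition $J$ with the projection $T^*Q\to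 T^*Q/SO(2,1)$ is a smooth submersion, such that a function $f$ on $\mathbb R^3\times(0,\infty)\times\mathbb R$ is smooth if and only if $f\circ J$ is smooth, and $\{f\circ J,g\circ J\}=\{f,g\}\circ J$ for all smooth $f,g$. Moreover $\Phi$ can be chosen independently of the masses and the potential, with $q\circ J$ equal to the Riemannian distance of the bodies, and such that the following holds. 3. For all $\mu_1,\mu_2>0$ and all differentiable $U:(0,\infty)\to\mathbb R$, the reduced dynamics is Hamiltonian with respect to this bracket, with the Hamiltonian $$H(\boldsymbol m,q,p)=\frac1{2\mu_1}\left((\boldsymbol m,\mathbf A(q)\boldsymbol m)-2m_xp+(1+\mu)p^2\right)+U(q),$$ $$\mathbf A(q)=\begin{pmatrix}1&0&0\\0&1&-\dfrac{\cosh q}{\sinh q}\\0&-\dfrac{\cosh q}{\sinh q}&\dfrac{\mu+\cosh^2q}{\sinh^2q}\end{pmatrix},\qquad \mu=\frac{\mu_1}{\mu_2}.$$ That is, the Hamiltonian $T+U$ on $T^*Q$ equals $H\circ J$, and $J$ maps solutions of Hamilton's equations of $T+U$ on $T^*Q$ to solutions of $\dot m_a=\{m_a,H\}$ $(a=x,y,z)$,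 $\dot q=\{q,H\}$, $\dot p=\{p,H\}$. 4. The function $C(\boldsymbol m)=-\langle\boldsymbol m,\boldsymbol m\rangle_{\mathrm K}=-m_x^2-m_y^2+m_z^2$ is a Casimir function of this bracket: $\{C,f\}=0$ for every smooth $f$. It is the only one up to functional dependence: the differential of every Casimir function $F$ is a multiple of $dC$ at every point with $\boldsymbol m\ne0$. -/

import Mathlib

open Set Topology Matrix Manifold ContDiff

noncomputable section

namespace TwoBodyL2

/-! ### Minkowski space and the Lobachevsky plane -/

/-- The matrix `K = diag(1, 1, -1)`. -/
def K : Matrix (Fin 3) (Fin 3) ℝ := Matrix.diagonal ![1, 1, -1]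

/-- The Minkowski scalar product `⟨u, v⟩_K = (u, K v)` on `ℝ³`. -/
def mink (u v : Fin 3 → ℝ) : ℝ := u ⬝ᵥ (K *ᵥ v)

theorem mink_eq (u v : Fin 3 → ℝ) : mink u v = u 0 * v 0 + u 1 * v 1 - u 2 * v 2 := by
  simp [mink, K, Matrix.mulVec_diagonal, dotProduct, Fin.sum_univ_three]
  ring

theorem mink_mulVec (g : Matrix (Fin 3) (Fin 3) ℝ) (u v : Fin 3 → ℝ) :
    mink (g *ᵥ u) (g *ᵥ v) = u ⬝ᵥ ((gᵀ * K * g) *ᵥ v) := by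
  rw [mink, ← Matrix.vecMul_transpose, ← Matrix.dotProduct_mulVec]
  simp only [Matrix.mulVec_mulVec, Matrix.mul_assoc]

/-- The Lobachevsky plane: the upper sheet of the hyperboloid `X² + Y² - Z² = -1` in `ℝ³`. -/
def L2 : Set (Fin 3 → ℝ) := {R | mink R R = -1 ∧ 0 < R 2}

/-- The tangent space of the Lobachevsky plane at `R`. The restriction of `mink` to it is the
Riemannian metric. -/
def tangentL2 (R : L2) : Submodule ℝ (Fin 3 → ℝ) where
  carrier := {v | mink R v = 0}
  add_mem' := by
    intro a b ha hb
    change mink R a = 0 at ha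
    change mink R b = 0 at hb
    change mink R (a + b) = 0
    simp only [mink_eq, Pi.add_apply] at *
    linarith
  zero_mem' := by simp [mink_eq]
  smul_mem' := by
    intro c a ha
    change mink R a = 0 at ha
    change mink R (c • a) = 0
    simp only [mink_eq, Pi.smul_apply, smul_eq_mul] at *
    linear_combination c * ha

theorem mem_tangentL2 {R : L2} {v : Fin 3 → ℝ} : v ∈ tangentL2 R ↔ mink R v = 0 := Iff.rfl

/-- The Riemannian length of a curve `[0, 1] → L2`. -/
def curveLength (c : ℝ → Fin 3 → ℝ) : ℝ :=
  ∫ t in (0 : ℝ)..1, Real.sqrt (mink (deriv c t) (deriv c t))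

/-- The Riemannian distance of the Lobachevsky plane: the infimum of the lengths of the `C¹`
curves in `L2` that join the two points. -/
def riemDist (R S : L2) : ℝ :=
  sInf {l : ℝ | ∃ c : ℝ → Fin 3 → ℝ, ContDiff ℝ 1 c ∧ (∀ t ∈ Icc (0 : ℝ) 1, c t ∈ L2) ∧
    c 0 = R ∧ c 1 = S ∧ l = curveLength c}

/-! ### The symmetry group -/

/-- The group `SO(2,1)` of orientation preserving isometries of the Lobachevsky plane: the matrices
`g` with `det g = 1` and `gᵀ K g = K` that map the upper sheet of the hyperboloid to itself. -/
def SO21 : Subgroup (Matrix.SpecialLinearGroup (Fin 3) ℝ) where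
  carrier := {g | (g : Matrix (Fin 3) (Fin 3) ℝ)ᵀ * K * (g : Matrix (Fin 3) (Fin 3) ℝ) = K ∧
    ∀ R ∈ L2, (g : Matrix (Fin 3) (Fin 3) ℝ) *ᵥ R ∈ L2}
  one_mem' := by simp
  mul_mem' := by
    rintro a b ⟨ha, ha'⟩ ⟨hb, hb'⟩
    refine ⟨?_, fun R hR => ?_⟩
    · rw [Matrix.SpecialLinearGroup.coe_mul, Matrix.transpose_mul]
      calc _ = (b : Matrix (Fin 3) (Fin 3) ℝ)ᵀ *
            ((a : Matrix (Fin 3) (Fin 3) ℝ)ᵀ * K * (a : Matrix (Fin 3) (Fin 3) ℝ)) *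
            (b : Matrix (Fin 3) (Fin 3) ℝ) := by simp only [Matrix.mul_assoc]
        _ = K := by rw [ha, hb]
    · rw [Matrix.SpecialLinearGroup.coe_mul, ← Matrix.mulVec_mulVec]
      exact ha' _ (hb' _ hR)
  inv_mem' := by
    rintro a ⟨ha, ha'⟩
    have h1 : (a : Matrix (Fin 3) (Fin 3) ℝ) * ((a⁻¹ : Matrix.SpecialLinearGroup (Fin 3) ℝ) :
        Matrix (Fin 3) (Fin 3) ℝ) = 1 := by
      rw [← Matrix.SpecialLinearGroup.coe_mul, mul_inv_cancel, Matrix.SpecialLinearGroup.coe_one]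
    have h2 : (((a⁻¹ : Matrix.SpecialLinearGroup (Fin 3) ℝ) : Matrix (Fin 3) (Fin 3) ℝ))ᵀ * K *
        ((a⁻¹ : Matrix.SpecialLinearGroup (Fin 3) ℝ) : Matrix (Fin 3) (Fin 3) ℝ) = K := by
      set b := ((a⁻¹ : Matrix.SpecialLinearGroup (Fin 3) ℝ) : Matrix (Fin 3) (Fin 3) ℝ)
      calc bᵀ * K * b = bᵀ * ((a : Matrix (Fin 3) (Fin 3) ℝ)ᵀ * K *
            (a : Matrix (Fin 3) (Fin 3) ℝ)) * b := by rw [ha]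
        _ = ((a : Matrix (Fin 3) (Fin 3) ℝ) * b)ᵀ * K *
            ((a : Matrix (Fin 3) (Fin 3) ℝ) * b) := by
          simp only [Matrix.transpose_mul, Matrix.mul_assoc]
        _ = K := by rw [h1]; simp
    refine ⟨h2, fun R hR => ?_⟩
    set b := ((a⁻¹ : Matrix.SpecialLinearGroup (Fin 3) ℝ) : Matrix (Fin 3) (Fin 3) ℝ)
    have hq : mink (b *ᵥ R) (b *ᵥ R) = -1 := by
      have : mink (b *ᵥ R) (b *ᵥ R) = R ⬝ᵥ ((bᵀ * K * b) *ᵥ R) := by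
        exact mink_mulVec b R R
      rw [this, h2]
      exact hR.1
    refine ⟨hq, ?_⟩
    by_contra hneg
    have h0 : (b *ᵥ R) 2 ≠ 0 := by
      intro h
      rw [mink_eq, h] at hq
      nlinarith [mul_self_nonneg ((b *ᵥ R) 0), mul_self_nonneg ((b *ᵥ R) 1)]
    have hlt : (b *ᵥ R) 2 < 0 := lt_of_le_of_ne (not_lt.1 hneg) h0
    have hm : -(b *ᵥ R) ∈ L2 := by
      refine ⟨?_, by simpa using hlt⟩
      rw [mink_eq] at hq ⊢
      simpa using hq
    have h3 := (ha' _ hm).2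
    rw [Matrix.mulVec_neg, Matrix.mulVec_mulVec, h1, Matrix.one_mulVec] at h3
    have h4 := hR.2
    simp only [Pi.neg_apply] at h3
    linarith

/-- The action of a matrix of `SO21` on vectors. -/
def act (g : SO21) (v : Fin 3 → ℝ) : Fin 3 → ℝ :=
  ((g : Matrix.SpecialLinearGroup (Fin 3) ℝ) : Matrix (Fin 3) (Fin 3) ℝ) *ᵥ v

theorem act_one (v : Fin 3 → ℝ) : act 1 v = v := by simp [act]

theorem act_mul (g h : SO21) (v : Fin 3 → ℝ) : act (g * h) v = act g (act h v) := by
  simp [act, Matrix.mulVec_mulVec]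

theorem act_mem (g : SO21) {R : Fin 3 → ℝ} (hR : R ∈ L2) : act g R ∈ L2 := g.2.2 R hR

theorem act_inv_act (g : SO21) (v : Fin 3 → ℝ) : act g⁻¹ (act g v) = v := by
  rw [← act_mul, inv_mul_cancel, act_one]

theorem act_act_inv (g : SO21) (v : Fin 3 → ℝ) : act g (act g⁻¹ v) = v := by
  rw [← act_mul, mul_inv_cancel, act_one]

theorem mink_act (g : SO21) (u v : Fin 3 → ℝ) : mink (act g u) (act g v) = mink u v := by
  rw [act, act, mink_mulVec, g.2.1, mink]

/-- The isometry of `L2` given by `g`. -/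
def actL2 (g : SO21) (R : L2) : L2 := ⟨act g R, act_mem g R.2⟩

/-- The inverse of the derivative at `R` of the isometry given by `g`, as a linear map
`T_{gR} L2 → T_R L2`. -/
def tangentInv (g : SO21) (R : L2) : tangentL2 (actL2 g R) →ₗ[ℝ] tangentL2 R where
  toFun v := ⟨act g⁻¹ v, by
    have h : mink (act g R) v = 0 := v.2
    rw [mem_tangentL2, ← mink_act g, act_act_inv]
    exact h⟩
  map_add' u v := by
    ext1
    simp [act, Matrix.mulVec_add]
  map_smul' c v := by
    ext1
    simp [act, Matrix.mulVec_smul]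

/-! ### The phase space `T*Q` -/

/-- The momentum phase space `T*Q` for `Q = (L2 × L2) \ Δ`, where `Δ` is the collision set (the
diagonal). A point consists of the positions `R 0 ≠ R 1` of the two bodies and of a linear form
on the tangent space `T_{R 0} L2 × T_{R 1} L2` of `Q`, that is, of a linear form on each factor. -/
structure PhaseSpace where
  /-- the positions of the two bodies -/
  R : Fin 2 → L2
  /-- the bodies do not collide -/
  ne : R 0 ≠ R 1
  /-- the momentum covectors of the two bodies -/
  α : ∀ a, Module.Dual ℝ (tangentL2 (R a))

theorem PhaseSpace.ext_covec {z w : PhaseSpace} (hR : ∀ a, (z.R a : Fin 3 → ℝ) = w.R a)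
    (hα : ∀ a v (hv : v ∈ tangentL2 (z.R a)) (hw : v ∈ tangentL2 (w.R a)),
      z.α a ⟨v, hv⟩ = w.α a ⟨v, hw⟩) : z = w := by
  obtain ⟨R, h, α⟩ := z
  obtain ⟨S, h', β⟩ := w
  obtain rfl : R = S := funext fun a => Subtype.ext (hR a)
  congr 1
  funext a
  ext ⟨v, hv⟩
  exact hα a v hv hv

/-- The cotangent lift of the diagonal action of `SO21` on `Q`:
`g • (R, α) = (g R, α ∘ (D g)⁻¹)`. -/
instance : SMul SO21 PhaseSpace where
  smul g z :=
    { R := fun a => actL2 g (z.R a)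
      ne := fun h => z.ne (Subtype.ext (by
        have h1 : act g (z.R 0) = act g (z.R 1) := congrArg Subtype.val h
        rw [← act_inv_act g (z.R 0), h1, act_inv_act]))
      α := fun a => z.α a ∘ₗ tangentInv g (z.R a) }

theorem smul_R (g : SO21) (z : PhaseSpace) (a : Fin 2) :
    ((g • z).R a : Fin 3 → ℝ) = act g (z.R a) := rfl

theorem smul_α (g : SO21) (z : PhaseSpace) (a : Fin 2) (v : Fin 3 → ℝ)
    (hv : v ∈ tangentL2 ((g • z).R a)) (hv' : act g⁻¹ v ∈ tangentL2 (z.R a)) :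
    (g • z).α a ⟨v, hv⟩ = z.α a ⟨act g⁻¹ v, hv'⟩ := rfl

instance : MulAction SO21 PhaseSpace where
  one_smul z := by
    refine PhaseSpace.ext_covec (fun a => by rw [smul_R, act_one]) fun a v hv hw => ?_
    have h : act 1⁻¹ v = v := by rw [inv_one, act_one]
    rw [smul_α 1 z a v hv (by rw [h]; exact hw)]
    congr 2
  mul_smul g h z := by
    refine PhaseSpace.ext_covec (fun a => by rw [smul_R, smul_R, smul_R, act_mul])
      fun a v hv hw => ?_
    have e : act (g * h)⁻¹ v = act h⁻¹ (act g⁻¹ v) := by rw [_root_.mul_inv_rev, act_mul]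
    have h1 : act g⁻¹ v ∈ tangentL2 ((h • z).R a) := by
      rw [mem_tangentL2, ← mink_act g, act_act_inv]
      exact hw
    have h2 : act h⁻¹ (act g⁻¹ v) ∈ tangentL2 (z.R a) := by
      rw [mem_tangentL2, ← mink_act h, act_act_inv]
      exact h1
    rw [smul_α (g * h) z a v hv (by rw [e]; exact h2), smul_α g (h • z) a v hw h1,
      smul_α h z a _ h1 h2]
    congr 2

/-! ### Canonical coordinates, smooth structure and canonical Poisson bracket of `T*Q`

The projection `(X, Y, Z) ↦ (X, Y)` is a global chart of `L2` (a graph over `ℝ²`), so that the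
coordinates `(X, Y)` of the two bodies form a global chart of `Q` and induce global canonical
coordinates `(x, ξ)` on `T*Q`. The first index of a coordinate is the body, the second one chooses
between `X` and `Y`. -/

/-- The model space of `T*Q`: positions and momenta. -/
abbrev Model : Type := (Fin 2 × Fin 2 → ℝ) × (Fin 2 × Fin 2 → ℝ)

/-- The coordinate vector field `∂/∂X` (for `j = 0`) or `∂/∂Y` (for `j = 1`) of the chart `(X, Y)`
of `L2`; as a vector of `ℝ³`, it is `(1, 0, X / Z)` or `(0, 1, Y / Z)`. -/
def coordVec (R : L2) (j : Fin 2) : tangentL2 R :=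
  ⟨![![1, 0] j, ![0, 1] j, (R : Fin 3 → ℝ) j.castSucc / (R : Fin 3 → ℝ) 2], by
    have h : (R : Fin 3 → ℝ) 2 ≠ 0 := R.2.2.ne'
    rw [mem_tangentL2, mink_eq]
    fin_cases j <;> simp <;> field_simp <;> ring⟩

/-- The canonical coordinates: the coordinates `(X, Y)` of the bodies, and the values of the
covectors on the coordinate vector fields `∂/∂X`, `∂/∂Y`. -/
def coords (z : PhaseSpace) : Model :=
  (fun i => (z.R i.1 : Fin 3 → ℝ) i.2.castSucc, fun i => z.α i.1 (coordVec (z.R i.1) i.2))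

/-- The point of `L2` above `(X, Y)`. -/
def lift (x : Fin 2 → ℝ) : L2 :=
  ⟨![x 0, x 1, Real.sqrt (1 + x 0 ^ 2 + x 1 ^ 2)], by
    constructor
    · rw [mink_eq]
      have := Real.mul_self_sqrt (show 0 ≤ 1 + x 0 ^ 2 + x 1 ^ 2 by positivity)
      simp
      linarith
    · simp
      positivity⟩

theorem L2_ext {R S : L2} (h0 : (R : Fin 3 → ℝ) 0 = (S : Fin 3 → ℝ) 0)
    (h1 : (R : Fin 3 → ℝ) 1 = (S : Fin 3 → ℝ) 1) : R = S := by
  have hR := R.2.1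
  have hS := S.2.1
  have pR := R.2.2
  have pS := S.2.2
  rw [mink_eq] at hR hS
  rw [h0, h1] at hR
  have h2 : (R : Fin 3 → ℝ) 2 = (S : Fin 3 → ℝ) 2 := by nlinarith
  ext i
  fin_cases i <;> assumption

theorem tangent_eq (R : L2) (v : tangentL2 R) :
    v = (v : Fin 3 → ℝ) 0 • coordVec R 0 + (v : Fin 3 → ℝ) 1 • coordVec R 1 := by
  have h : (R : Fin 3 → ℝ) 2 ≠ 0 := R.2.2.ne'
  have hv : mink R v = 0 := v.2
  rw [mink_eq] at hv
  ext i
  fin_cases i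
  · simp [coordVec]
  · simp [coordVec]
  · simp [coordVec]
    field_simp
    linarith

theorem coords_injective : Function.Injective coords := by
  intro z w h
  obtain ⟨R, hR, α⟩ := z
  obtain ⟨S, hS, β⟩ := w
  have hx := congrArg Prod.fst h
  have hξ := congrArg Prod.snd h
  obtain rfl : R = S := funext fun a => L2_ext (congrFun hx (a, 0)) (congrFun hx (a, 1))
  congr 1
  funext a
  ext1 v
  have h0 : α a (coordVec (R a) 0) = β a (coordVec (R a) 0) := congrFun hξ (a, 0)
  have h1 : α a (coordVec (R a) 1) = β a (coordVec (R a) 1) := congrFun hξ (a, 1)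
  rw [tangent_eq (R a) v]
  simp only [map_add, map_smul, h0, h1]

theorem range_coords :
    range coords = {y : Model | (fun j => y.1 (0, j)) ≠ (fun j => y.1 (1, j))} := by
  ext ⟨x, ξ⟩
  constructor
  · rintro ⟨z, hz⟩ h
    have hx := congrArg Prod.fst hz
    refine z.ne (L2_ext ?_ ?_)
    · exact (congrFun hx (0, 0)).trans ((congrFun h 0).trans (congrFun hx (1, 0)).symm)
    · exact (congrFun hx (0, 1)).trans ((congrFun h 1).trans (congrFun hx (1, 1)).symm)
  · intro h
    refine ⟨⟨fun a => lift fun j => x (a, j), fun h' => h ?_, fun a =>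
      (ξ (a, 0) • LinearMap.proj 0 + ξ (a, 1) • LinearMap.proj 1) ∘ₗ (tangentL2 _).subtype⟩, ?_⟩
    · have h1 := congrArg Subtype.val h'
      funext j
      fin_cases j
      · exact congrFun h1 0
      · exact congrFun h1 1
    · refine Prod.ext (funext fun i => ?_) (funext fun i => ?_)
      · obtain ⟨a, j⟩ := i
        fin_cases j <;> simp [coords, lift]
      · obtain ⟨a, j⟩ := i
        fin_cases j <;> simp [coords, coordVec]

instance : Nonempty PhaseSpace := by
  have h : ((fun i => if i.1 = 0 then 0 else 1, 0) : Model) ∈ range coords := by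
    rw [range_coords]
    intro h
    have := congrFun h 0
    simp at this
  exact ⟨h.choose⟩

instance : TopologicalSpace PhaseSpace := TopologicalSpace.induced coords inferInstance

theorem isOpenEmbedding_coords : IsOpenEmbedding coords where
  eq_induced := rfl
  injective := coords_injective
  isOpen_range := by
    rw [range_coords]
    exact isOpen_ne_fun (by fun_prop) (by fun_prop)

/-- `T*Q` is a smooth manifold of dimension 8 with the global chart `coords`. -/
instance : ChartedSpace Model PhaseSpace := isOpenEmbedding_coords.singletonChartedSpace

instance : IsManifold 𝓘(ℝ, Model) ∞ PhaseSpace := isOpenEmbedding_coords.isManifold_singleton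

/-- The derivative of a function on `T*Q` in the canonical coordinates. -/
def coordDeriv (f : PhaseSpace → ℝ) (z : PhaseSpace) : Model →L[ℝ] ℝ :=
  fderiv ℝ (f ∘ (isOpenEmbedding_coords.toOpenPartialHomeomorph coords).symm) (coords z)

/-- The partial derivative `∂f/∂x_i`. -/
def dpos (i : Fin 2 × Fin 2) (f : PhaseSpace → ℝ) (z : PhaseSpace) : ℝ :=
  coordDeriv f z (Pi.single i 1, 0)

/-- The partial derivative `∂f/∂ξ_i`. -/
def dmom (i : Fin 2 × Fin 2) (f : PhaseSpace → ℝ) (z : PhaseSpace) : ℝ :=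
  coordDeriv f z (0, Pi.single i 1)

/-- The canonical Poisson bracket on `T*Q`, with `{x_i, ξ_j} = δ_ij`. -/
def canonicalBracket (f g : PhaseSpace → ℝ) (z : PhaseSpace) : ℝ :=
  ∑ i, (dpos i f z * dmom i g z - dmom i f z * dpos i g z)

/-- The curve `c` in `T*Q` satisfies at time `t` Hamilton's canonical equations `ẋ = ∂H/∂ξ`,
`ξ̇ = -∂H/∂x`. -/
def HamiltonEqAt (H : PhaseSpace → ℝ) (c : ℝ → PhaseSpace) (t : ℝ) : Prop :=
  HasDerivAt (coords ∘ c) (fun i => dmom i H (c t), fun i => -dpos i H (c t)) t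

/-! ### The two-body Hamiltonian -/

/-- The kinetic energy of a velocity vector `v ∈ T_{R 0} L2 × T_{R 1} L2`, for the masses `μ`. -/
def kineticVelocity (μ : Fin 2 → ℝ) {R : Fin 2 → L2} (v : ∀ a, tangentL2 (R a)) : ℝ :=
  (1 / 2) * ∑ a, μ a * mink (v a) (v a)

/-- The kinetic energy as a function on `T*Q`: the Legendre transform of `kineticVelocity`. -/
def kinetic (μ : Fin 2 → ℝ) (z : PhaseSpace) : ℝ :=
  ⨆ v : ∀ a, tangentL2 (z.R a), (∑ a, z.α a (v a) - kineticVelocity μ v)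

/-- The Hamiltonian `H = T + U` on `T*Q`, where `U` is evaluated at the Riemannian distance of the
bodies. -/
def hamiltonian (μ : Fin 2 → ℝ) (U : ℝ → ℝ) (z : PhaseSpace) : ℝ :=
  kinetic μ z + U (riemDist (z.R 0) (z.R 1))

/-! ### The model `ℝ³ × (0, ∞) × ℝ` of the reduced space -/

/-- The ambient space `ℝ³ × ℝ × ℝ` of the points `(m, q, p)`. -/
abbrev E5 : Type := (Fin 3 → ℝ) × ℝ × ℝ

/-- The set `ℝ³ × (0, ∞) × ℝ` of the points `(m, q, p)` with `q > 0`. -/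
def reducedSet : Set E5 := {x | 0 < x.2.1}

/-- The gradient of `f` with respect to `m = (m_x, m_y, m_z)`. -/
def gradm (f : E5 → ℝ) (x : E5) : Fin 3 → ℝ := fun a => fderiv ℝ f x (Pi.single a 1, 0, 0)

/-- The partial derivative `∂f/∂q`. -/
def dq (f : E5 → ℝ) (x : E5) : ℝ := fderiv ℝ f x (0, 1, 0)

/-- The partial derivative `∂f/∂p`. -/
def dp (f : E5 → ℝ) (x : E5) : ℝ := fderiv ℝ f x (0, 0, 1)

/-- The bracket on `ℝ³ × (0, ∞) × ℝ` that is the derivation in each argument determined by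
`{m_x, m_y} = m_z`, `{m_y, m_z} = -m_x`, `{m_z, m_x} = -m_y`, `{q, p} = 1`, the other brackets of
coordinate functions being zero. -/
def reducedBracket (f g : E5 → ℝ) (x : E5) : ℝ :=
  x.1 2 * (gradm f x 0 * gradm g x 1 - gradm f x 1 * gradm g x 0)
    - x.1 0 * (gradm f x 1 * gradm g x 2 - gradm f x 2 * gradm g x 1)
    - x.1 1 * (gradm f x 2 * gradm g x 0 - gradm f x 0 * gradm g x 2)
    + (dq f x * dp g x - dp f x * dq g x)

/-- The coordinate function `m_a` on `ℝ³ × ℝ × ℝ`. -/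
def mCoord (a : Fin 3) (x : E5) : ℝ := x.1 a

/-- The coordinate function `q`. -/
def qCoord (x : E5) : ℝ := x.2.1

/-- The coordinate function `p`. -/
def pCoord (x : E5) : ℝ := x.2.2

/-- `B` is a Poisson bracket on the smooth functions on the (open) set `s`. -/
structure IsPoissonBracketOn (s : Set E5) (B : (E5 → ℝ) → (E5 → ℝ) → E5 → ℝ) : Prop where
  smooth : ∀ f g, ContDiffOn ℝ ∞ f s → ContDiffOn ℝ ∞ g s → ContDiffOn ℝ ∞ (B f g) s
  skew : ∀ f g, ContDiffOn ℝ ∞ f s → ContDiffOn ℝ ∞ g s → ∀ x ∈ s, B f g x = -B g f x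
  add : ∀ f g h, ContDiffOn ℝ ∞ f s → ContDiffOn ℝ ∞ g s → ContDiffOn ℝ ∞ h s →
    ∀ x ∈ s, B (f + g) h x = B f h x + B g h x
  smul : ∀ (c : ℝ) f g, ContDiffOn ℝ ∞ f s → ContDiffOn ℝ ∞ g s →
    ∀ x ∈ s, B (c • f) g x = c * B f g x
  leibniz : ∀ f g h, ContDiffOn ℝ ∞ f s → ContDiffOn ℝ ∞ g s → ContDiffOn ℝ ∞ h s →
    ∀ x ∈ s, B (f * g) h x = f x * B g h x + g x * B f h x
  jacobi : ∀ f g h, ContDiffOn ℝ ∞ f s → ContDiffOn ℝ ∞ g s → ContDiffOn ℝ ∞ h s →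
    ∀ x ∈ s, B f (B g h) x + B g (B h f) x + B h (B f g) x = 0

/-- `F` is a Casimir function of the bracket `B` on the smooth functions on `s`. -/
def IsCasimirOn (s : Set E5) (B : (E5 → ℝ) → (E5 → ℝ) → E5 → ℝ) (F : E5 → ℝ) : Prop :=
  ContDiffOn ℝ ∞ F s ∧ ∀ g, ContDiffOn ℝ ∞ g s → ∀ x ∈ s, B F g x = 0

/-- The function `C(m) = -⟨m, m⟩_K = -m_x² - m_y² + m_z²`. -/
def casimir (x : E5) : ℝ := -mink x.1 x.1

/-- The matrix `A(q)`, where `μ` is the mass ratio `μ₁ / μ₂`. -/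
def A (μ q : ℝ) : Matrix (Fin 3) (Fin 3) ℝ :=
  !![1, 0, 0;
     0, 1, -(Real.cosh q / Real.sinh q);
     0, -(Real.cosh q / Real.sinh q), (μ + Real.cosh q ^ 2) / Real.sinh q ^ 2]

/-- The reduced Hamiltonian
`H(m, q, p) = (1 / 2μ₁) ((m, A(q) m) - 2 m_x p + (1 + μ) p²) + U(q)`, with `μ = μ₁ / μ₂`. -/
def reducedHamiltonian (μ₁ μ₂ : ℝ) (U : ℝ → ℝ) (x : E5) : ℝ :=
  1 / (2 * μ₁) * (x.1 ⬝ᵥ (A (μ₁ / μ₂) x.2.1 *ᵥ x.1) - 2 * x.1 0 * x.2.2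
    + (1 + μ₁ / μ₂) * x.2.2 ^ 2) + U x.2.1

/-- The Hamiltonian vector field of `H` for the bracket `reducedBracket`: its components are
`{m_a, H}`, `{q, H}`, `{p, H}`. -/
def reducedVectorField (H : E5 → ℝ) (x : E5) : E5 :=
  (fun a => reducedBracket (mCoord a) H x, reducedBracket qCoord H x, reducedBracket pCoord H x)

/-! ### The Lie algebra `so(2,1)` -/

attribute [local instance 100] LieRing.ofAssociativeRing

/-- The Lie algebra `so(2,1)` of the matrices `ξ` with `ξᵀ K + K ξ = 0`, with the commutator. -/
abbrev so21 : LieSubalgebra ℝ (Matrix (Fin 3) (Fin 3) ℝ) := skewAdjointMatricesLieSubalgebra K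

/-- The matrix `ω̂ K`, where `ω̂` is the matrix of the vector product with `ω`. -/
def tilde (w : Fin 3 → ℝ) : Matrix (Fin 3) (Fin 3) ℝ :=
  !![0, -w 2, w 1; w 2, 0, -w 0; -w 1, w 0, 0] * K

end TwoBodyL2

end

attribute [local instance 100] LieRing.ofAssociativeRing

/-!
The angular momentum of the two bodies, expressed in the moving frame of the pair (the unit normal
of the geodesic through the bodies, the unit tangent at the first body, and the first body itself),
is invariant under `SO(2,1)`; together with the distance `q` and the momentum `p` of the second body
along the geodesic it gives the five coordinates of the reduced space. The frame is an element of
`SO(2,1)`, so every orbit contains exactly one point whose frame is the standard one: this is a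
smooth section of the reduction map.

The map is Poisson because the velocity `∂f/∂ξ` of a function `f(m, q, p)` is the rotation of the
pair with the angular velocity `∇ₘf` (read in the moving frame) composed with the motion of the
second body along the geodesic with the speed `∂f/∂p`, and the moving frame is simply carried along
by such a motion. The equations of motion then follow from the Poisson property, and the Jacobi
identity holds because the Poisson tensor on the reduced space is affine.
-/

noncomputable section

namespace TwoBodyL2

/-! ### Poisson brackets of tensor fields -/

section TensorBracket

variable {E : Type*} [NormedAddCommGroup E] [NormedSpace ℝ E]

/-- The bracket `{f, g} = df (P dg)` of functions on `E` that is determined by a contravariant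
2-tensor field `P`. The field is encoded by the maps `P x` from covectors to vectors, so that
`P x (dg)` is the Hamiltonian vector of `g`. -/
def tensorBracket (P : E → (E →L[ℝ] ℝ) →L[ℝ] E) (f g : E → ℝ) (x : E) : ℝ :=
  fderiv ℝ f x (P x (fderiv ℝ g x))

/-- A Poisson tensor: a skew-symmetric differentiable field `P` whose Schouten bracket `[P, P]`
vanishes. -/
structure IsPoissonTensor (P : E → (E →L[ℝ] ℝ) →L[ℝ] E) : Prop where
  skew : ∀ (x : E) (α β : E →L[ℝ] ℝ), α (P x β) = -β (P x α)
  differentiable : Differentiable ℝ P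
  schouten : ∀ (x : E) (α β γ : E →L[ℝ] ℝ),
    β (fderiv ℝ P x (P x α) γ) + γ (fderiv ℝ P x (P x β) α) + α (fderiv ℝ P x (P x γ) β) = 0

variable {P : E → (E →L[ℝ] ℝ) →L[ℝ] E} {f g h : E → ℝ} {x : E}

theorem tensorBracket_add_left (hf : DifferentiableAt ℝ f x) (hg : DifferentiableAt ℝ g x) :
    tensorBracket P (f + g) h x = tensorBracket P f h x + tensorBracket P g h x := by
  simp only [tensorBracket, fderiv_add hf hg, _root_.add_apply]

theorem tensorBracket_smul_left (hf : DifferentiableAt ℝ f x) (c : ℝ) :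
    tensorBracket P (c • f) g x = c * tensorBracket P f g x := by
  simp only [tensorBracket, fderiv_const_smul hf, _root_.smul_apply, smul_eq_mul]

theorem tensorBracket_mul_left (hf : DifferentiableAt ℝ f x) (hg : DifferentiableAt ℝ g x) :
    tensorBracket P (f * g) h x = f x * tensorBracket P g h x + g x * tensorBracket P f h x := by
  simp only [tensorBracket, fderiv_mul hf hg, _root_.add_apply, _root_.smul_apply, smul_eq_mul]

theorem contDiffOn_tensorBracket {s : Set E} (hs : IsOpen s) (hP : ContDiffOn ℝ ∞ P s)
    (hf : ContDiffOn ℝ ∞ f s) (hg : ContDiffOn ℝ ∞ g s) :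
    ContDiffOn ℝ ∞ (tensorBracket P f g) s :=
  (hf.fderiv_of_isOpen hs (by simp)).clm_apply (hP.clm_apply (hg.fderiv_of_isOpen hs (by simp)))

theorem IsPoissonTensor.tensorBracket_skew (hP : IsPoissonTensor P) :
    tensorBracket P f g x = -tensorBracket P g f x :=
  hP.skew x _ _

theorem IsPoissonTensor.fderiv_tensorBracket (hP : IsPoissonTensor P) (hf : ContDiffAt ℝ 2 f x)
    (hg : ContDiffAt ℝ 2 g x) (v : E) :
    fderiv ℝ (tensorBracket P f g) x v =
      fderiv ℝ (fderiv ℝ f) x v (P x (fderiv ℝ g x)) +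
        fderiv ℝ f x (fderiv ℝ P x v (fderiv ℝ g x)) -
        fderiv ℝ (fderiv ℝ g) x v (P x (fderiv ℝ f x)) := by
  have differentiableAt_fderiv {k : E → ℝ} (hk : ContDiffAt ℝ 2 k x) :
      HasFDerivAt (fderiv ℝ k) (fderiv ℝ (fderiv ℝ k) x) x :=
    ((hk.fderiv_right (m := 1) le_rfl).differentiableAt one_ne_zero).hasFDerivAt
  have hfg := (differentiableAt_fderiv hf).clm_apply
    ((hP.differentiable x).hasFDerivAt.clm_apply (differentiableAt_fderiv hg))
  have hfg' : fderiv ℝ (tensorBracket P f g) x = _ := hfg.fderiv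
  simp only [hfg', _root_.add_apply, ContinuousLinearMap.comp_apply,
    ContinuousLinearMap.flip_apply, map_add, hP.skew x (fderiv ℝ f x)]
  ring

theorem IsPoissonTensor.tensorBracket_jacobi (hP : IsPoissonTensor P) (hf : ContDiffAt ℝ 2 f x)
    (hg : ContDiffAt ℝ 2 g x) (hh : ContDiffAt ℝ 2 h x) :
    tensorBracket P f (tensorBracket P g h) x + tensorBracket P g (tensorBracket P h f) x +
      tensorBracket P h (tensorBracket P f g) x = 0 := by
  have apply_eq (k l : E → ℝ) :
      tensorBracket P k l x = -fderiv ℝ l x (P x (fderiv ℝ k x)) := hP.skew x _ _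
  rw [apply_eq f, apply_eq g, apply_eq h, hP.fderiv_tensorBracket hg hh,
    hP.fderiv_tensorBracket hh hf, hP.fderiv_tensorBracket hf hg]
  have symm {k : E → ℝ} (hk : ContDiffAt ℝ 2 k x) := hk.isSymmSndFDerivAt (by simp)
  -- The second derivatives cancel in pairs by symmetry; the first ones leave the Schouten bracket.
  linear_combination -hP.schouten x (fderiv ℝ f x) (fderiv ℝ g x) (fderiv ℝ h x)
    - symm hf (P x (fderiv ℝ h x)) (P x (fderiv ℝ g x))
    - symm hg (P x (fderiv ℝ f x)) (P x (fderiv ℝ h x))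
    - symm hh (P x (fderiv ℝ g x)) (P x (fderiv ℝ f x))

theorem hasFDerivAt_affine {F : Type*} [NormedAddCommGroup F] [NormedSpace ℝ F] (L : E →L[ℝ] F)
    (c : F) (x : E) : HasFDerivAt (fun x => L x + c) L x :=
  L.hasFDerivAt.add_const c

theorem isPoissonTensor_affine {L : E →L[ℝ] (E →L[ℝ] ℝ) →L[ℝ] E} {c : (E →L[ℝ] ℝ) →L[ℝ] E}
    (skew : ∀ (x : E) (α β : E →L[ℝ] ℝ), α ((L x + c) β) = -β ((L x + c) α))
    (schouten : ∀ (x : E) (α β γ : E →L[ℝ] ℝ),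
      β (L ((L x + c) α) γ) + γ (L ((L x + c) β) α) + α (L ((L x + c) γ) β) = 0) :
    IsPoissonTensor fun x => L x + c where
  skew := skew
  differentiable x := (hasFDerivAt_affine L c x).differentiableAt
  schouten x := by
    rw [(hasFDerivAt_affine L c x).fderiv]
    exact schouten x

end TensorBracket

/-! ### Vector algebra of Minkowski space -/

theorem mink_comm (u v : Fin 3 → ℝ) : mink u v = mink v u := by
  simp only [mink_eq, mul_comm]

theorem mink_add_left (u v w : Fin 3 → ℝ) : mink (u + v) w = mink u w + mink v w :=
  add_dotProduct _ _ _

theorem mink_sub_left (u v w : Fin 3 → ℝ) : mink (u - v) w = mink u w - mink v w :=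
  sub_dotProduct _ _ _

theorem mink_smul_left (c : ℝ) (u v : Fin 3 → ℝ) : mink (c • u) v = c * mink u v :=
  smul_dotProduct _ _ _

theorem mink_add_right (u v w : Fin 3 → ℝ) : mink u (v + w) = mink u v + mink u w := by
  simp only [mink_comm u, mink_add_left]

theorem mink_sub_right (u v w : Fin 3 → ℝ) : mink u (v - w) = mink u v - mink u w := by
  simp only [mink_comm u, mink_sub_left]

theorem mink_smul_right (c : ℝ) (u v : Fin 3 → ℝ) : mink u (c • v) = c * mink u v := by
  simp only [mink_comm u, mink_smul_left]

theorem mink_neg_left (u v : Fin 3 → ℝ) : mink (-u) v = -mink u v :=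
  neg_dotProduct _ _

theorem mink_neg_right (u v : Fin 3 → ℝ) : mink u (-v) = -mink u v := by
  simp only [mink_comm u, mink_neg_left]

theorem eq_of_mink_eq {u v : Fin 3 → ℝ} (h : ∀ w, mink u w = mink v w) : u = v := by
  ext i
  have hi := h (Pi.single i 1)
  fin_cases i <;> simpa [mink_eq] using hi

/-- The vector product `K (u × v)` of Minkowski space, as a continuous bilinear map. -/
def mcross : (Fin 3 → ℝ) →L[ℝ] (Fin 3 → ℝ) →L[ℝ] Fin 3 → ℝ :=
  (crossProduct.compr₂ K.mulVecLin).toContinuousBilinearMap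

theorem mcross_apply (u v : Fin 3 → ℝ) : mcross u v = K *ᵥ (u ⨯₃ v) := rfl

theorem mcross_eq (u v : Fin 3 → ℝ) :
    mcross u v =
      ![u 1 * v 2 - u 2 * v 1, u 2 * v 0 - u 0 * v 2, -(u 0 * v 1 - u 1 * v 0)] := by
  ext i
  fin_cases i <;> simp [mcross_apply, cross_apply, K, Matrix.mulVec_diagonal]

theorem mcross_anticomm (u v : Fin 3 → ℝ) : mcross u v = -mcross v u := by
  rw [mcross_apply, mcross_apply, ← Matrix.mulVec_neg, cross_anticomm]

theorem mcross_neg_left (u v : Fin 3 → ℝ) : mcross (-u) v = mcross v u := by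
  rw [mcross_anticomm, map_neg, neg_neg]

theorem mcross_self (u : Fin 3 → ℝ) : mcross u u = 0 := by
  rw [mcross_apply, cross_self, Matrix.mulVec_zero]

theorem mink_mcross_eq_det (u v w : Fin 3 → ℝ) :
    mink (mcross u v) w = (Matrix.of ![u, v, w]).det := by
  simp only [mink_eq, mcross_eq, Matrix.cons_val, Matrix.det_fin_three, Matrix.of_apply]
  ring

theorem mink_mcross_left (u v : Fin 3 → ℝ) : mink u (mcross u v) = 0 := by
  simp only [mink_eq, mcross_eq, Matrix.cons_val]
  ring

theorem mink_mcross_right (u v : Fin 3 → ℝ) : mink v (mcross u v) = 0 := by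
  simp only [mink_eq, mcross_eq, Matrix.cons_val]
  ring

theorem mink_mcross_mcross (u v w x : Fin 3 → ℝ) :
    mink (mcross u v) (mcross w x) = mink u x * mink v w - mink u w * mink v x := by
  simp only [mink_eq, mcross_eq, Matrix.cons_val]
  ring

theorem mcross_mcross_right (u v w : Fin 3 → ℝ) :
    mcross u (mcross v w) = mink u v • w - mink u w • v := by
  ext i
  fin_cases i <;> simp [mink_eq, mcross_eq] <;> ring

theorem mcross_leibniz (u v w : Fin 3 → ℝ) :
    mcross u (mcross v w) = mcross (mcross u v) w + mcross v (mcross u w) := by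
  rw [mcross_anticomm (mcross u v)]
  simp only [mcross_mcross_right, mink_comm w]
  rw [mink_comm v u]
  module

theorem act_sub (g : SO21) (u v : Fin 3 → ℝ) : act g (u - v) = act g u - act g v :=
  Matrix.mulVec_sub _ _ _

theorem act_smul (g : SO21) (c : ℝ) (v : Fin 3 → ℝ) : act g (c • v) = c • act g v :=
  Matrix.mulVec_smul _ _ _

theorem mcross_act (g : SO21) (u v : Fin 3 → ℝ) :
    mcross (act g u) (act g v) = act g (mcross u v) := by
  refine eq_of_mink_eq fun w => ?_
  have rows_mul : Matrix.of ![act g u, act g v, act g (act g⁻¹ w)] =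
      Matrix.of ![u, v, act g⁻¹ w] * (g.1.1)ᵀ := by
    simp [act, Matrix.cons_mul, Matrix.vecMul_transpose]
  rw [← act_act_inv g w, mink_act, mink_mcross_eq_det, mink_mcross_eq_det, rows_mul,
    Matrix.det_mul, Matrix.det_transpose, g.1.2, mul_one]

/-- `mink` as a continuous bilinear form. -/
def minkCLM : (Fin 3 → ℝ) →L[ℝ] (Fin 3 → ℝ) →L[ℝ] ℝ :=
  (Matrix.toLinearMap₂' ℝ K).toContinuousBilinearMap

theorem minkCLM_apply (u v : Fin 3 → ℝ) : minkCLM u v = mink u v :=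
  Matrix.toLinearMap₂'_apply' K u v

theorem hasDerivAt_mink {u v : ℝ → Fin 3 → ℝ} {u' v' : Fin 3 → ℝ} {t : ℝ}
    (hu : HasDerivAt u u' t) (hv : HasDerivAt v v' t) :
    HasDerivAt (fun t => mink (u t) (v t)) (mink u' (v t) + mink (u t) v') t := by
  simp only [← minkCLM_apply]
  exact (minkCLM.hasFDerivAt.comp_hasDerivAt t hu).clm_apply hv

theorem hasDerivAt_mcross {u v : ℝ → Fin 3 → ℝ} {u' v' : Fin 3 → ℝ} {t : ℝ}
    (hu : HasDerivAt u u' t) (hv : HasDerivAt v v' t) :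
    HasDerivAt (fun t => mcross (u t) (v t)) (mcross u' (v t) + mcross (u t) v') t :=
  (mcross.hasFDerivAt.comp_hasDerivAt t hu).clm_apply hv

/-! ### The reduced bracket -/

theorem isOpen_reducedSet : IsOpen reducedSet :=
  isOpen_lt continuous_const (continuous_fst.comp continuous_snd)

theorem differentiableAt_of_contDiffOn_reducedSet {f : E5 → ℝ} (hf : ContDiffOn ℝ ∞ f reducedSet)
    {x : E5} (hx : x ∈ reducedSet) : DifferentiableAt ℝ f x :=
  (hf.contDiffAt (isOpen_reducedSet.mem_nhds hx)).differentiableAt (by simp)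

/-- The components of a covector on `ℝ³ × ℝ × ℝ` along the factor `ℝ³`. -/
def covecGrad : (E5 →L[ℝ] ℝ) →L[ℝ] (Fin 3 → ℝ) :=
  ContinuousLinearMap.pi fun k => ContinuousLinearMap.apply ℝ ℝ (Pi.single k 1, 0, 0)

theorem covec_apply (α : E5 →L[ℝ] ℝ) (v : E5) :
    α v = v.1 ⬝ᵥ covecGrad α + v.2.1 * α (0, 1, 0) + v.2.2 * α (0, 0, 1) := by
  have v_eq : v = ∑ k, v.1 k • ((Pi.single k 1, 0, 0) : E5) + v.2.1 • ((0, 1, 0) : E5) +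
      v.2.2 • ((0, 0, 1) : E5) := by
    refine Prod.ext (funext fun i => ?_) (Prod.ext ?_ ?_)
    · fin_cases i <;> simp [Fin.sum_univ_three]
    · simp [Fin.sum_univ_three]
    · simp [Fin.sum_univ_three]
  conv_lhs => rw [v_eq]
  simp only [map_add, map_sum, map_smul, smul_eq_mul]
  rfl

/-- The Lie–Poisson part `α ↦ (K m × ∇α, 0, 0)` of the reduced Poisson tensor at `(m, q, p)`. -/
def liePoissonTensor : E5 →L[ℝ] (E5 →L[ℝ] ℝ) →L[ℝ] E5 :=
  LinearMap.toContinuousBilinearMap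
    ((crossProduct.compl₁₂ (K.mulVecLin ∘ₗ LinearMap.fst ℝ (Fin 3 → ℝ) (ℝ × ℝ))
      covecGrad.toLinearMap).compr₂ (LinearMap.inl ℝ (Fin 3 → ℝ) (ℝ × ℝ)))

/-- The canonical part `α ↦ (0, α(∂_p), -α(∂_q))` of the reduced Poisson tensor. -/
def canonicalTensor : (E5 →L[ℝ] ℝ) →L[ℝ] E5 :=
  (0 : (E5 →L[ℝ] ℝ) →L[ℝ] (Fin 3 → ℝ)).prod
    ((ContinuousLinearMap.apply ℝ ℝ (0, 0, 1)).prod (-ContinuousLinearMap.apply ℝ ℝ (0, 1, 0)))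

/-- The Poisson tensor of `reducedBracket`. -/
def reducedTensor (x : E5) : (E5 →L[ℝ] ℝ) →L[ℝ] E5 := liePoissonTensor x + canonicalTensor

theorem liePoissonTensor_apply (x : E5) (α : E5 →L[ℝ] ℝ) :
    liePoissonTensor x α = ((K *ᵥ x.1) ⨯₃ covecGrad α, 0, 0) := rfl

theorem reducedTensor_apply (x : E5) (α : E5 →L[ℝ] ℝ) :
    reducedTensor x α = ((K *ᵥ x.1) ⨯₃ covecGrad α, α (0, 0, 1), -α (0, 1, 0)) := by
  refine Prod.ext ?_ (Prod.ext ?_ ?_)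
  · exact add_zero _
  · exact zero_add _
  · exact zero_add _

theorem contDiff_reducedTensor : ContDiff ℝ ∞ reducedTensor := by
  unfold reducedTensor
  fun_prop

theorem isPoissonTensor_reducedTensor : IsPoissonTensor reducedTensor := by
  refine isPoissonTensor_affine (fun x α β => ?_) (fun x α β γ => ?_)
  · have cross_part : (K *ᵥ x.1) ⨯₃ covecGrad β ⬝ᵥ covecGrad α =
        -((K *ᵥ x.1) ⨯₃ covecGrad α ⬝ᵥ covecGrad β) := by
      rw [dotProduct_comm, triple_product_permutation, triple_product_permutation,
        ← cross_anticomm, dotProduct_neg, dotProduct_comm]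
    change α (reducedTensor x β) = -β (reducedTensor x α)
    rw [covec_apply α, covec_apply β]
    simp only [reducedTensor_apply, cross_part]
    ring
  · change β (liePoissonTensor (reducedTensor x α) γ) + γ (liePoissonTensor (reducedTensor x β) α) +
      α (liePoissonTensor (reducedTensor x γ) β) = 0
    simp only [covec_apply _ (liePoissonTensor _ _)]
    simp only [liePoissonTensor_apply, reducedTensor_apply, cross_apply, K, vec3_dotProduct,
      Matrix.mulVec_diagonal, Matrix.cons_val]
    ring

theorem tensorBracket_reducedTensor : tensorBracket reducedTensor = reducedBracket := by
  funext f g x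
  rw [tensorBracket, covec_apply, reducedTensor_apply, reducedBracket]
  change _ ⬝ᵥ gradm f x + dp g x * dq f x + -dq g x * dp f x = _
  rw [show covecGrad (fderiv ℝ g x) = gradm g x from rfl]
  simp only [cross_apply, K, vec3_dotProduct, Matrix.mulVec_diagonal, Matrix.cons_val]
  ring

theorem isPoissonBracketOn_reducedBracket : IsPoissonBracketOn reducedSet reducedBracket := by
  rw [← tensorBracket_reducedTensor]
  refine ⟨fun f g hf hg => ?_, fun f g _ _ x _ => ?_, fun f g h hf hg _ x hx => ?_,
    fun c f g hf _ x hx => ?_, fun f g h hf hg _ x hx => ?_, fun f g h hf hg hh x hx => ?_⟩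
  · exact contDiffOn_tensorBracket isOpen_reducedSet contDiff_reducedTensor.contDiffOn hf hg
  · exact isPoissonTensor_reducedTensor.tensorBracket_skew
  · exact tensorBracket_add_left (differentiableAt_of_contDiffOn_reducedSet hf hx)
      (differentiableAt_of_contDiffOn_reducedSet hg hx)
  · exact tensorBracket_smul_left (differentiableAt_of_contDiffOn_reducedSet hf hx) c
  · exact tensorBracket_mul_left (differentiableAt_of_contDiffOn_reducedSet hf hx)
      (differentiableAt_of_contDiffOn_reducedSet hg hx)
  · have contDiffAt_two {k : E5 → ℝ} (hk : ContDiffOn ℝ ∞ k reducedSet) : ContDiffAt ℝ 2 k x :=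
      (hk.contDiffAt (isOpen_reducedSet.mem_nhds hx)).of_le
        (WithTop.coe_le_coe.2 (le_top : (2 : ℕ∞) ≤ ⊤))
    exact isPoissonTensor_reducedTensor.tensorBracket_jacobi (contDiffAt_two hf)
      (contDiffAt_two hg) (contDiffAt_two hh)

theorem tensorBracket_clm_left (P : E5 → (E5 →L[ℝ] ℝ) →L[ℝ] E5) (α : E5 →L[ℝ] ℝ) (g : E5 → ℝ)
    (x : E5) : tensorBracket P α g x = α (P x (fderiv ℝ g x)) := by
  rw [tensorBracket, α.fderiv]

/-- The coordinate `m_a` as a continuous linear form. -/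
def mCoordL (a : Fin 3) : E5 →L[ℝ] ℝ :=
  (ContinuousLinearMap.proj a).comp (ContinuousLinearMap.fst ℝ (Fin 3 → ℝ) (ℝ × ℝ))

/-- The coordinate `q` as a continuous linear form. -/
def qCoordL : E5 →L[ℝ] ℝ :=
  (ContinuousLinearMap.fst ℝ ℝ ℝ).comp (ContinuousLinearMap.snd ℝ (Fin 3 → ℝ) (ℝ × ℝ))

/-- The coordinate `p` as a continuous linear form. -/
def pCoordL : E5 →L[ℝ] ℝ :=
  (ContinuousLinearMap.snd ℝ ℝ ℝ).comp (ContinuousLinearMap.snd ℝ (Fin 3 → ℝ) (ℝ × ℝ))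

theorem reducedBracket_clm (α β : E5 →L[ℝ] ℝ) (x : E5) :
    reducedBracket α β x = α (reducedTensor x β) := by
  rw [← tensorBracket_reducedTensor, tensorBracket_clm_left, β.fderiv]

theorem reducedBracket_coord (x : E5) :
    reducedBracket (mCoord 0) (mCoord 1) x = mCoord 2 x ∧
      reducedBracket (mCoord 1) (mCoord 2) x = -mCoord 0 x ∧
      reducedBracket (mCoord 2) (mCoord 0) x = -mCoord 1 x ∧
      reducedBracket qCoord pCoord x = 1 ∧
      ∀ a, reducedBracket (mCoord a) qCoord x = 0 ∧ reducedBracket (mCoord a) pCoord x = 0 := by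
  refine ⟨(reducedBracket_clm (mCoordL 0) (mCoordL 1) x).trans ?_,
    (reducedBracket_clm (mCoordL 1) (mCoordL 2) x).trans ?_,
    (reducedBracket_clm (mCoordL 2) (mCoordL 0) x).trans ?_,
    (reducedBracket_clm qCoordL pCoordL x).trans ?_, fun a =>
    ⟨(reducedBracket_clm (mCoordL a) qCoordL x).trans ?_,
      (reducedBracket_clm (mCoordL a) pCoordL x).trans ?_⟩⟩
  case refine_5 | refine_6 =>
    rw [reducedTensor_apply]
    change ((K *ᵥ x.1) ⨯₃ 0) a = 0
    rw [map_zero, Pi.zero_apply]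
  all_goals
    simp [reducedTensor_apply, mCoordL, qCoordL, pCoordL, mCoord, covecGrad, K, cross_apply,
      Matrix.mulVec_diagonal]

/-! ### The Lie algebra `so(2,1)` -/

theorem tilde_eq (w : Fin 3 → ℝ) :
    tilde w = !![0, -w 2, -w 1; w 2, 0, w 0; -w 1, w 0, 0] := by
  ext i j
  fin_cases i <;> fin_cases j <;> simp [tilde, K]

theorem mem_so21_iff {M : Matrix (Fin 3) (Fin 3) ℝ} : M ∈ so21 ↔ Mᵀ * K = K * -M := by
  rw [mem_skewAdjointMatricesLieSubalgebra, mem_skewAdjointMatricesSubmodule]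
  rfl

theorem tilde_mem (w : Fin 3 → ℝ) : tilde w ∈ so21 := by
  rw [mem_so21_iff, tilde_eq]
  ext i j
  fin_cases i <;> fin_cases j <;> simp [K]

/-- The isomorphism of `ℝ³` and `so(2,1)` given by `tilde`. -/
def tildeEquiv : (Fin 3 → ℝ) ≃ₗ[ℝ] so21 where
  toFun w := ⟨tilde w, tilde_mem w⟩
  map_add' u v := by
    ext i j
    simp only [tilde_eq]
    fin_cases i <;> fin_cases j <;> simp <;> ring
  map_smul' c v := by
    ext i j
    simp only [tilde_eq]
    fin_cases i <;> fin_cases j <;> simp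
  invFun M := ![M.1 1 2, -M.1 2 0, M.1 1 0]
  left_inv w := by
    ext i
    fin_cases i <;> simp [tilde_eq]
  right_inv M := by
    obtain ⟨M, hM⟩ := M
    have entries (i j : Fin 3) : (Mᵀ * K) i j = (K * -M) i j := by rw [mem_so21_iff.1 hM]
    simp [K, Fin.forall_fin_succ] at entries
    ext i j
    simp only [tilde_eq]
    fin_cases i <;> fin_cases j <;> simp <;> linarith

theorem tildeEquiv_mcross (u v : Fin 3 → ℝ) :
    tildeEquiv (mcross u v) = ⁅tildeEquiv u, tildeEquiv v⁆ := by
  refine Subtype.ext ?_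
  change tilde (mcross u v) = ⁅tilde u, tilde v⁆
  rw [Ring.lie_def]
  ext i j
  simp only [tilde_eq, mcross_eq]
  fin_cases i <;> fin_cases j <;> simp <;> ring

theorem reducedBracket_eq_liePoisson (f g : E5 → ℝ) (x : E5) :
    reducedBracket f g x =
      -(x.1 ⬝ᵥ tildeEquiv.symm ⁅tildeEquiv (gradm f x), tildeEquiv (gradm g x)⁆)
        + (dq f x * dp g x - dp f x * dq g x) := by
  rw [← tildeEquiv_mcross, LinearEquiv.symm_apply_apply, mcross_eq, vec3_dotProduct,
    reducedBracket]
  simp only [Matrix.cons_val]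
  ring

/-! ### Casimir functions -/

theorem hasFDerivAt_casimir (x : E5) :
    HasFDerivAt casimir (-(2 : ℝ) • (minkCLM x.1).comp (ContinuousLinearMap.fst ℝ _ _)) x := by
  have hfst : HasFDerivAt (Prod.fst : E5 → Fin 3 → ℝ) (ContinuousLinearMap.fst ℝ _ _) x :=
    hasFDerivAt_fst
  have h := (minkCLM.hasFDerivAt_of_bilinear hfst hfst).neg
  refine (h.congr_fderiv (ContinuousLinearMap.ext fun v => ?_)).congr_of_eventuallyEq
    (Filter.Eventually.of_forall fun y => ?_)
  · change -(minkCLM x.1 v.1 + minkCLM v.1 x.1) = -2 * minkCLM x.1 v.1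
    rw [minkCLM_apply, minkCLM_apply, mink_comm v.1]
    ring
  · simp [minkCLM_apply, casimir]

theorem covecGrad_fderiv_casimir (x : E5) :
    covecGrad (fderiv ℝ casimir x) = -(2 : ℝ) • K *ᵥ x.1 := by
  rw [(hasFDerivAt_casimir x).fderiv]
  ext i
  fin_cases i <;> simp [covecGrad, minkCLM_apply, mink_eq, K, Matrix.mulVec_diagonal]

theorem reducedTensor_fderiv_casimir (x : E5) : reducedTensor x (fderiv ℝ casimir x) = 0 := by
  have vertical : fderiv ℝ casimir x (0, 0, 1) = 0 ∧ fderiv ℝ casimir x (0, 1, 0) = 0 := by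
    simp [(hasFDerivAt_casimir x).fderiv]
  rw [reducedTensor_apply, covecGrad_fderiv_casimir, map_smul, cross_self, vertical.1, vertical.2]
  simp

theorem isCasimirOn_casimir : IsCasimirOn reducedSet reducedBracket casimir := by
  refine ⟨ContDiff.contDiffOn ?_, fun g _ x _ => ?_⟩
  · unfold casimir
    simp only [mink_eq]
    fun_prop
  · rw [← tensorBracket_reducedTensor, isPoissonTensor_reducedTensor.tensorBracket_skew,
      tensorBracket, reducedTensor_fderiv_casimir, map_zero, neg_zero]

theorem exists_eq_smul_of_cross_eq_zero {u v : Fin 3 → ℝ} (hu : u ≠ 0) (h : u ⨯₃ v = 0) :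
    ∃ l : ℝ, v = l • u := by
  by_contra! hv
  exact crossProduct_ne_zero_iff_linearIndependent.2
    ((LinearIndependent.pair_iff' hu).2 fun l => (hv l).symm) h

theorem exists_eq_smul_of_reducedTensor_eq_zero {x : E5} {α : E5 →L[ℝ] ℝ} (hm : x.1 ≠ 0)
    (h : reducedTensor x α = 0) : ∃ l : ℝ, α = l • fderiv ℝ casimir x := by
  rw [reducedTensor_apply, Prod.mk_eq_zero, Prod.mk_eq_zero, neg_eq_zero] at h
  have hK : K *ᵥ x.1 ≠ 0 := fun h0 => hm <| eq_of_mink_eq fun w => by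
    rw [mink_comm, mink, h0, mink, dotProduct_zero, zero_dotProduct]
  obtain ⟨l, hl⟩ := exists_eq_smul_of_cross_eq_zero hK h.1
  refine ⟨-l / 2, ContinuousLinearMap.ext fun v => ?_⟩
  have hC := reducedTensor_fderiv_casimir x
  rw [reducedTensor_apply, Prod.mk_eq_zero, Prod.mk_eq_zero, neg_eq_zero] at hC
  rw [_root_.smul_apply, covec_apply, covec_apply (fderiv ℝ casimir x), h.2.1, h.2.2, hC.2.1,
    hC.2.2, hl, covecGrad_fderiv_casimir]
  simp
  ring

theorem IsCasimirOn.exists_fderiv_eq_smul {F : E5 → ℝ}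
    (hF : IsCasimirOn reducedSet reducedBracket F) {x : E5} (hx : x ∈ reducedSet)
    (hm : x.1 ≠ 0) : ∃ l : ℝ, fderiv ℝ F x = l • fderiv ℝ casimir x := by
  refine exists_eq_smul_of_reducedTensor_eq_zero hm ?_
  have commutes (α : E5 →L[ℝ] ℝ) : α (reducedTensor x (fderiv ℝ F x)) = 0 := by
    rw [← tensorBracket_clm_left, isPoissonTensor_reducedTensor.tensorBracket_skew,
      tensorBracket_reducedTensor, hF.2 α α.contDiff.contDiffOn x hx, neg_zero]
  exact Prod.ext (funext fun a => commutes (mCoordL a))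
    (Prod.ext (commutes qCoordL) (commutes pCoordL))

theorem mink_sq_le_of_tangent {c u v : Fin 3 → ℝ} (hc : mink c c = -1) (hu : mink c u = 0)
    (hv : mink c v = 0) : mink u v ^ 2 ≤ mink u u * mink v v := by
  have mcross_eq_zero : mcross c (mcross u v) = 0 := by
    rw [mcross_mcross_right, hu, hv, zero_smul, zero_smul, sub_zero]
  have lagrange := mink_mcross_mcross u v u v
  have parallel := mink_mcross_mcross c (mcross u v) c (mcross u v)
  rw [mcross_eq_zero, hc, mink_comm _ c] at parallel
  rw [mink_comm v u] at lagrange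
  have zero_left : mink 0 0 = 0 := by rw [mink_eq]; simp
  nlinarith [sq_nonneg (mink c (mcross u v))]

theorem mink_sq_le_of_unit {c n v : Fin 3 → ℝ} (hc : mink c c = -1) (hn : mink n n = 1)
    (hv : mink c v = 0) : mink n v ^ 2 ≤ (1 + mink n c ^ 2) * mink v v := by
  have hu : mink c (n + mink n c • c) = 0 := by
    rw [mink_add_right, mink_smul_right, hc, mink_comm c n]
    ring
  have h := mink_sq_le_of_tangent hc hu hv
  simp only [mink_add_right, mink_smul_right, mink_add_left, mink_smul_left] at h
  rw [hv, hc, hn, mink_comm c n] at h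
  linarith

theorem mem_L2_of_mink_neg {a b : Fin 3 → ℝ} (ha : mink a a = -1) (hb : b ∈ L2)
    (h : mink a b < 0) : a ∈ L2 := by
  refine ⟨ha, ?_⟩
  obtain ⟨hb1, hb2⟩ := hb
  rw [mink_eq] at ha hb1 h
  have gram : (a 2 * b 2) ^ 2 - (a 0 * b 0 + a 1 * b 1) ^ 2 =
      1 + a 0 ^ 2 + a 1 ^ 2 + b 0 ^ 2 + b 1 ^ 2 + (a 0 * b 1 - a 1 * b 0) ^ 2 := by
    linear_combination -(b 2 ^ 2) * ha + (-1 - a 0 ^ 2 - a 1 ^ 2) * hb1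
  have mul_pos' : 0 < a 2 * b 2 := by
    by_contra! hn
    nlinarith [sq_nonneg (a 0 * b 1 - a 1 * b 0)]
  exact pos_of_mul_pos_left mul_pos' hb2.le

/-! ### Pairs of points of the Lobachevsky plane -/

/-- The hyperbolic cosine of the distance of two points of the Lobachevsky plane. -/
def chDist (a b : Fin 3 → ℝ) : ℝ := -mink a b

/-- The hyperbolic sine of the distance of two points of the Lobachevsky plane. -/
def shDist (a b : Fin 3 → ℝ) : ℝ := Real.sqrt (chDist a b ^ 2 - 1)

/-- The unit tangent vector at `a` that points towards `b`. -/
def dir₁ (a b : Fin 3 → ℝ) : Fin 3 → ℝ := (shDist a b)⁻¹ • (b - chDist a b • a)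

/-- The unit tangent vector at `b` that points away from `a`. -/
def dir₂ (a b : Fin 3 → ℝ) : Fin 3 → ℝ := (shDist a b)⁻¹ • (chDist a b • b - a)

/-- The unit normal vector of the geodesic through `a` and `b`. -/
def normal (a b : Fin 3 → ℝ) : Fin 3 → ℝ := (shDist a b)⁻¹ • mcross a b

theorem chDist_comm (a b : Fin 3 → ℝ) : chDist b a = chDist a b := by
  rw [chDist, mink_comm, chDist]

theorem shDist_comm (a b : Fin 3 → ℝ) : shDist b a = shDist a b := by
  rw [shDist, chDist_comm, shDist]

theorem dir₂_eq_neg_dir₁ (a b : Fin 3 → ℝ) : dir₂ a b = -dir₁ b a := by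
  rw [dir₁, chDist_comm, shDist_comm, dir₂, ← smul_neg, neg_sub]

theorem normal_comm (a b : Fin 3 → ℝ) : normal b a = -normal a b := by
  rw [normal, shDist_comm, normal, mcross_anticomm, smul_neg]

theorem mink_left_right (a b : Fin 3 → ℝ) : mink a b = -chDist a b := (neg_neg _).symm

theorem mink_left_normal (a b : Fin 3 → ℝ) : mink a (normal a b) = 0 := by
  rw [normal, mink_smul_right, mink_mcross_left, mul_zero]

theorem mink_right_normal (a b : Fin 3 → ℝ) : mink b (normal a b) = 0 := by
  rw [normal, mink_smul_right, mink_mcross_right, mul_zero]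

theorem mink_dir₁_normal (a b : Fin 3 → ℝ) : mink (dir₁ a b) (normal a b) = 0 := by
  rw [dir₁, mink_smul_left, mink_sub_left, mink_smul_left, mink_left_normal, mink_right_normal,
    mul_zero, sub_zero, mul_zero]

theorem mink_dir₂_normal (a b : Fin 3 → ℝ) : mink (dir₂ a b) (normal a b) = 0 := by
  rw [dir₂_eq_neg_dir₁, normal_comm b a, mink_neg_left, mink_neg_right, mink_dir₁_normal, neg_zero,
    neg_zero]

theorem mcross_left_dir₁ (a b : Fin 3 → ℝ) : mcross a (dir₁ a b) = normal a b := by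
  rw [dir₁, map_smul, map_sub, map_smul, mcross_self, smul_zero, sub_zero, normal]

theorem one_lt_chDist {R S : L2} (h : R ≠ S) : 1 < chDist R S := by
  have hR := R.2.1
  have hS := S.2.1
  have mul_pos' := mul_pos R.2.2 S.2.2
  rw [mink_eq] at hR hS
  rw [chDist, mink_eq]
  have ne_coord : (R : Fin 3 → ℝ) 0 - S.1 0 ≠ 0 ∨ (R : Fin 3 → ℝ) 1 - S.1 1 ≠ 0 := by
    by_contra! heq
    exact h (L2_ext (sub_eq_zero.1 heq.1) (sub_eq_zero.1 heq.2))
  generalize (R : Fin 3 → ℝ) = a at *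
  generalize (S : Fin 3 → ℝ) = b at *
  have gram : (a 2 * b 2) ^ 2 - (1 + a 0 * b 0 + a 1 * b 1) ^ 2 =
      (a 0 - b 0) ^ 2 + (a 1 - b 1) ^ 2 + (a 0 * b 1 - a 1 * b 0) ^ 2 := by
    linear_combination -(b 2 ^ 2) * hR + (-1 - a 0 ^ 2 - a 1 ^ 2) * hS
  have sq_lt : (1 + a 0 * b 0 + a 1 * b 1) ^ 2 < (a 2 * b 2) ^ 2 := by
    rw [← sub_pos, gram]
    rcases ne_coord with h0 | h1 <;> positivity
  linarith [(abs_lt.1 (abs_lt_of_sq_lt_sq sq_lt mul_pos'.le)).2]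

/-- `a` and `b` lie on the hyperboloid of unit timelike vectors, on the same sheet, and are
distinct. -/
structure IsPair (a b : Fin 3 → ℝ) : Prop where
  left : mink a a = -1
  right : mink b b = -1
  one_lt : 1 < chDist a b

theorem isPair_of_ne {R S : L2} (h : R ≠ S) : IsPair R S := ⟨R.2.1, S.2.1, one_lt_chDist h⟩

namespace IsPair

variable {a b : Fin 3 → ℝ}

theorem symm (h : IsPair a b) : IsPair b a := ⟨h.right, h.left, by rw [chDist_comm]; exact h.one_lt⟩

theorem chDist_sq_sub_one_pos (h : IsPair a b) : 0 < chDist a b ^ 2 - 1 := by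
  nlinarith [h.one_lt]

theorem chDist_ne_zero (h : IsPair a b) : chDist a b ≠ 0 := (one_pos.trans h.one_lt).ne'

theorem shDist_pos (h : IsPair a b) : 0 < shDist a b := Real.sqrt_pos.2 h.chDist_sq_sub_one_pos

theorem shDist_ne_zero (h : IsPair a b) : shDist a b ≠ 0 := h.shDist_pos.ne'

theorem shDist_sq (h : IsPair a b) : shDist a b ^ 2 = chDist a b ^ 2 - 1 :=
  Real.sq_sqrt h.chDist_sq_sub_one_pos.le

theorem cosh_arsinh_shDist (h : IsPair a b) :
    Real.cosh (Real.arsinh (shDist a b)) = chDist a b := by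
  rw [Real.cosh_arsinh, h.shDist_sq, add_sub_cancel, Real.sqrt_sq (by linarith [h.one_lt])]

theorem mink_left_dir₁ (h : IsPair a b) : mink a (dir₁ a b) = 0 := by
  rw [dir₁, mink_smul_right, mink_sub_right, mink_smul_right, h.left, mink_left_right]
  ring

theorem mink_right_dir₁ (h : IsPair a b) : mink b (dir₁ a b) = shDist a b := by
  rw [dir₁, mink_smul_right, mink_sub_right, mink_smul_right, h.right, mink_comm b,
    mink_left_right, inv_mul_eq_iff_eq_mul₀ h.shDist_ne_zero]
  linear_combination -h.shDist_sq

theorem mink_right_dir₂ (h : IsPair a b) : mink b (dir₂ a b) = 0 := by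
  rw [dir₂_eq_neg_dir₁, ← neg_one_smul ℝ, mink_smul_right, h.symm.mink_left_dir₁, mul_zero]

theorem mink_dir₁_dir₁ (h : IsPair a b) : mink (dir₁ a b) (dir₁ a b) = 1 := by
  rw [dir₁, mink_smul_left, mink_sub_left, mink_smul_left, ← dir₁, h.mink_left_dir₁,
    h.mink_right_dir₁, mul_zero, sub_zero, inv_mul_cancel₀ h.shDist_ne_zero]

theorem mink_dir₂_dir₂ (h : IsPair a b) : mink (dir₂ a b) (dir₂ a b) = 1 := by
  rw [dir₂_eq_neg_dir₁, mink_neg_left, mink_neg_right, neg_neg, h.symm.mink_dir₁_dir₁]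

theorem mink_normal_normal (h : IsPair a b) : mink (normal a b) (normal a b) = 1 := by
  have hs := h.shDist_ne_zero
  have lagrange : mink (mcross a b) (mcross a b) = shDist a b ^ 2 := by
    rw [mink_mcross_mcross, h.left, h.right, mink_comm b, mink_left_right, h.shDist_sq]
    ring
  rw [normal, mink_smul_left, mink_smul_right, lagrange]
  field_simp

theorem shDist_smul_dir₁ (h : IsPair a b) : shDist a b • dir₁ a b = b - chDist a b • a :=
  smul_inv_smul₀ h.shDist_ne_zero _

theorem shDist_smul_dir₂ (h : IsPair a b) : shDist a b • dir₂ a b = chDist a b • b - a :=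
  smul_inv_smul₀ h.shDist_ne_zero _

theorem right_eq (h : IsPair a b) : b = shDist a b • dir₁ a b + chDist a b • a := by
  rw [h.shDist_smul_dir₁, sub_add_cancel]

theorem dir₂_eq (h : IsPair a b) : dir₂ a b = chDist a b • dir₁ a b + shDist a b • a := by
  rw [dir₂, inv_smul_eq_iff₀ h.shDist_ne_zero, smul_add, smul_comm, h.shDist_smul_dir₁, smul_smul,
    ← sq, h.shDist_sq]
  module

theorem mcross_normal_dir₁ (h : IsPair a b) : mcross (normal a b) (dir₁ a b) = a := by
  rw [mcross_anticomm, normal, map_smul, mcross_mcross_right, mink_comm _ a,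
    mink_comm _ b, h.mink_left_dir₁, h.mink_right_dir₁, zero_smul, zero_sub, smul_neg, neg_neg,
    inv_smul_smul₀ h.shDist_ne_zero]

theorem mcross_left_normal (h : IsPair a b) : mcross a (normal a b) = -dir₁ a b := by
  rw [← mcross_left_dir₁, mcross_mcross_right, h.left, h.mink_left_dir₁, neg_one_smul, zero_smul,
    sub_zero]

theorem mcross_normal_right (h : IsPair a b) : mcross (normal a b) b = dir₂ a b := by
  have symm_normal := h.symm.mcross_left_normal
  rw [normal_comm, map_neg, neg_inj] at symm_normal
  rw [mcross_anticomm, symm_normal, dir₂_eq_neg_dir₁]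

theorem mcross_normal_left (h : IsPair a b) : mcross (normal a b) a = dir₁ a b := by
  rw [mcross_anticomm, h.mcross_left_normal, neg_neg]

theorem mcross_left_right (h : IsPair a b) : mcross a b = shDist a b • normal a b :=
  (smul_inv_smul₀ h.shDist_ne_zero _).symm

theorem mcross_left_dir₂ (h : IsPair a b) : mcross a (dir₂ a b) = chDist a b • normal a b := by
  rw [h.dir₂_eq, map_add, map_smul, map_smul, mcross_self, mcross_left_dir₁, smul_zero, add_zero]

theorem mcross_right_dir₁ (h : IsPair a b) : mcross b (dir₁ a b) = chDist a b • normal a b := by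
  have symm_left := h.symm.mcross_left_dir₂
  rwa [dir₂_eq_neg_dir₁, chDist_comm, normal_comm, map_neg, smul_neg, neg_inj] at symm_left

theorem mink_left_dir₂ (h : IsPair a b) : mink a (dir₂ a b) = -shDist a b := by
  rw [h.dir₂_eq, mink_add_right, mink_smul_right, mink_smul_right, h.mink_left_dir₁, h.left]
  ring

theorem tangent_left (h : IsPair a b) {v : Fin 3 → ℝ} (hv : mink a v = 0) :
    v = mink v (dir₁ a b) • dir₁ a b + mink v (normal a b) • normal a b := by
  have left_cross : mcross a (mcross v a) = v := by
    rw [mcross_mcross_right, hv, h.left, zero_smul, neg_one_smul, zero_sub, neg_neg]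
  have right_cross := mcross_mcross_right v (normal a b) (dir₁ a b)
  rw [h.mcross_normal_dir₁] at right_cross
  rw [right_cross, map_sub, map_smul, map_smul, mcross_left_dir₁, h.mcross_left_normal]
    at left_cross
  conv_lhs => rw [← left_cross]
  module

theorem tangent_right (h : IsPair a b) {v : Fin 3 → ℝ} (hv : mink b v = 0) :
    v = mink v (dir₂ a b) • dir₂ a b + mink v (normal a b) • normal a b := by
  have symm_tangent := h.symm.tangent_left hv
  rw [normal_comm, ← neg_neg (dir₁ b a), ← dir₂_eq_neg_dir₁, ← neg_one_smul ℝ (dir₂ a b),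
    ← neg_one_smul ℝ (normal a b), mink_smul_right, mink_smul_right] at symm_tangent
  conv_lhs => rw [symm_tangent]
  module

end IsPair

theorem chDist_act (g : SO21) (a b : Fin 3 → ℝ) : chDist (act g a) (act g b) = chDist a b := by
  rw [chDist, mink_act, chDist]

theorem shDist_act (g : SO21) (a b : Fin 3 → ℝ) : shDist (act g a) (act g b) = shDist a b := by
  rw [shDist, chDist_act, shDist]

theorem dir₁_act (g : SO21) (a b : Fin 3 → ℝ) : dir₁ (act g a) (act g b) = act g (dir₁ a b) := by
  rw [dir₁, dir₁, shDist_act, chDist_act, act_smul, act_sub, act_smul]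

theorem dir₂_act (g : SO21) (a b : Fin 3 → ℝ) : dir₂ (act g a) (act g b) = act g (dir₂ a b) := by
  rw [dir₂, dir₂, shDist_act, chDist_act, act_smul, act_sub, act_smul]

theorem normal_act (g : SO21) (a b : Fin 3 → ℝ) :
    normal (act g a) (act g b) = act g (normal a b) := by
  rw [normal, normal, shDist_act, mcross_act, act_smul]

/-! ### The moving frame of a pair -/

/-- The matrix whose columns are the moving frame of the pair `a`, `b`: the unit normal vector of
the geodesic, the unit tangent vector at `a` that points away from `b`, and `a`. -/
def bodyFrame (a b : Fin 3 → ℝ) : Matrix (Fin 3) (Fin 3) ℝ :=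
  (Matrix.of ![normal a b, -dir₁ a b, a])ᵀ

theorem bodyFrame_mulVec (a b w : Fin 3 → ℝ) :
    bodyFrame a b *ᵥ w = w 0 • normal a b - w 1 • dir₁ a b + w 2 • a := by
  ext i
  simp only [bodyFrame, Matrix.mulVec, dotProduct, Matrix.transpose_apply, Matrix.of_apply,
    Fin.sum_univ_three, Matrix.cons_val, Pi.neg_apply, Pi.add_apply, Pi.sub_apply, Pi.smul_apply,
    smul_eq_mul]
  ring

theorem of_mul_K_mul_transpose_apply (f : Fin 3 → Fin 3 → ℝ) (i j : Fin 3) :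
    (Matrix.of f * K * (Matrix.of f)ᵀ) i j = mink (f i) (f j) := by
  rw [Matrix.mul_apply]
  simp only [K, Matrix.mul_diagonal, Matrix.of_apply, Matrix.transpose_apply,
    Fin.sum_univ_three, Matrix.cons_val, mink_eq]
  ring

theorem IsPair.bodyFrame_transpose_mul_K_mul {a b : Fin 3 → ℝ} (h : IsPair a b) :
    (bodyFrame a b)ᵀ * K * bodyFrame a b = K := by
  ext i j
  rw [bodyFrame, Matrix.transpose_transpose, of_mul_K_mul_transpose_apply]
  fin_cases i <;> fin_cases j <;>
    simp [K, mink_neg_left, mink_neg_right, mink_comm (dir₁ a b) a, mink_comm (normal a b) a,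
      mink_comm (normal a b) (dir₁ a b), h.left, h.mink_left_dir₁, h.mink_dir₁_dir₁,
      h.mink_normal_normal, mink_left_normal, mink_dir₁_normal]

theorem IsPair.det_bodyFrame {a b : Fin 3 → ℝ} (h : IsPair a b) : (bodyFrame a b).det = 1 := by
  rw [bodyFrame, Matrix.det_transpose, ← mink_mcross_eq_det, map_neg, h.mcross_normal_dir₁,
    ← neg_one_smul ℝ a, mink_smul_left, h.left, neg_mul_neg, one_mul]

theorem IsPair.bodyFrame_mulVec_mem {a b R : Fin 3 → ℝ} (h : IsPair a b) (ha : a ∈ L2)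
    (hR : R ∈ L2) : bodyFrame a b *ᵥ R ∈ L2 := by
  have isometry : ∀ v, mink (bodyFrame a b *ᵥ R) (bodyFrame a b *ᵥ v) = mink R v := fun v => by
    rw [mink_mulVec, h.bodyFrame_transpose_mul_K_mul, mink]
  refine mem_L2_of_mink_neg ((isometry R).trans hR.1) ha ?_
  have eq_frame : a = bodyFrame a b *ᵥ ![0, 0, 1] := by
    simp [bodyFrame_mulVec]
  have neg := isometry ![0, 0, 1]
  rw [← eq_frame, mink_eq R] at neg
  simpa [neg] using hR.2

theorem PhaseSpace.isPair (z : PhaseSpace) : IsPair (z.R 0 : Fin 3 → ℝ) (z.R 1) :=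
  isPair_of_ne z.ne

/-- The moving frame of the two bodies, as the element of `SO21` that maps the standard frame
to it. -/
def PhaseSpace.frame (z : PhaseSpace) : SO21 :=
  ⟨⟨bodyFrame (z.R 0) (z.R 1), z.isPair.det_bodyFrame⟩, z.isPair.bodyFrame_transpose_mul_K_mul,
    fun _ hR => z.isPair.bodyFrame_mulVec_mem (z.R 0).2 hR⟩

namespace PhaseSpace

variable (z : PhaseSpace)

theorem act_frame (w : Fin 3 → ℝ) :
    act z.frame w =
      w 0 • normal (z.R 0 : Fin 3 → ℝ) (z.R 1) - w 1 • dir₁ (z.R 0 : Fin 3 → ℝ) (z.R 1) +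
        w 2 • (z.R 0 : Fin 3 → ℝ) :=
  bodyFrame_mulVec _ _ _

theorem act_frame_left : act z.frame ![0, 0, 1] = z.R 0 := by
  simp [act_frame]

theorem act_frame_right :
    act z.frame ![0, -shDist (z.R 0 : Fin 3 → ℝ) (z.R 1), chDist (z.R 0 : Fin 3 → ℝ) (z.R 1)] =
      z.R 1 := by
  simpa [act_frame] using z.isPair.right_eq.symm

end PhaseSpace

/-! ### The Riemannian distance -/

/-- The geodesic of unit speed that starts at `a` in the direction of `b`. -/
def geodesic (a b : Fin 3 → ℝ) (t : ℝ) : Fin 3 → ℝ := Real.cosh t • a + Real.sinh t • dir₁ a b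

theorem hasDerivAt_geodesic (a b : Fin 3 → ℝ) (t : ℝ) :
    HasDerivAt (geodesic a b) (Real.sinh t • a + Real.cosh t • dir₁ a b) t :=
  ((Real.hasDerivAt_cosh t).smul_const a).add ((Real.hasDerivAt_sinh t).smul_const _)

namespace IsPair

variable {a b : Fin 3 → ℝ}

theorem mink_left_dir₁_combination (h : IsPair a b) (x y : ℝ) :
    mink (x • a + y • dir₁ a b) (x • a + y • dir₁ a b) = y ^ 2 - x ^ 2 := by
  simp only [mink_add_left, mink_add_right, mink_smul_left, mink_smul_right, h.left,
    h.mink_left_dir₁, mink_comm (dir₁ a b) a, h.mink_dir₁_dir₁]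
  ring

theorem geodesic_mem (h : IsPair a b) (ha : a ∈ L2) (t : ℝ) : geodesic a b t ∈ L2 := by
  refine mem_L2_of_mink_neg ?_ ha ?_
  · rw [geodesic, h.mink_left_dir₁_combination]
    linear_combination -Real.cosh_sq t
  · rw [geodesic, mink_add_left, mink_smul_left, mink_smul_left, h.left, mink_comm _ a,
      h.mink_left_dir₁]
    linarith [Real.cosh_pos t]

theorem geodesic_arsinh_shDist (h : IsPair a b) : geodesic a b (Real.arsinh (shDist a b)) = b := by
  rw [geodesic, h.cosh_arsinh_shDist, Real.sinh_arsinh, add_comm, ← h.right_eq]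

theorem curveLength_geodesic (h : IsPair a b) {d : ℝ} (hd : 0 ≤ d) :
    curveLength (fun t => geodesic a b (t * d)) = d := by
  have speed (t : ℝ) : Real.sqrt (mink (deriv (fun t => geodesic a b (t * d)) t)
      (deriv (fun t => geodesic a b (t * d)) t)) = d := by
    have hder := (hasDerivAt_geodesic a b (t * d)).scomp t (hasDerivAt_mul_const d)
    rw [show deriv (fun t => geodesic a b (t * d)) t = _ from hder.deriv, mink_smul_left,
      mink_smul_right, h.mink_left_dir₁_combination, Real.cosh_sq, add_sub_cancel_left, mul_one,
      Real.sqrt_mul_self hd]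
  simp only [curveLength, speed, intervalIntegral.integral_const, sub_zero, one_smul]

end IsPair

theorem mink_deriv_eq_zero_of_mem_L2 {c : ℝ → Fin 3 → ℝ} (hc : ContDiff ℝ 1 c)
    (hL : ∀ t ∈ Icc (0 : ℝ) 1, c t ∈ L2) {t : ℝ} (ht : t ∈ Ioo (0 : ℝ) 1) :
    mink (c t) (deriv c t) = 0 := by
  have hder := (hc.differentiable one_ne_zero t).hasDerivAt
  have norm_const : (fun t => mink (c t) (c t)) =ᶠ[𝓝 t] fun _ => -1 :=
    Filter.eventually_of_mem (Ioo_mem_nhds ht.1 ht.2) fun u hu => (hL u (Ioo_subset_Icc_self hu)).1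
  have deriv_zero := (hasDerivAt_mink hder hder).unique
    ((hasDerivAt_const t (-1 : ℝ)).congr_of_eventuallyEq norm_const)
  rw [mink_comm (deriv c t)] at deriv_zero
  linarith

theorem continuous_speed {c : ℝ → Fin 3 → ℝ} (hc : ContDiff ℝ 1 c) :
    Continuous fun t => Real.sqrt (mink (deriv c t) (deriv c t)) := by
  have hder : Continuous (deriv c) := hc.continuous_deriv le_rfl
  simp only [← minkCLM_apply]
  exact ((minkCLM.continuous.comp hder).clm_apply hder).sqrt

/-- The function `arsinh ⟨n, ·⟩` is the signed distance to the geodesic with the unit normal `n`,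
which is 1-Lipschitz. -/
theorem arsinh_mink_sub_le_curveLength {n : Fin 3 → ℝ} (hn : mink n n = 1) {c : ℝ → Fin 3 → ℝ}
    (hc : ContDiff ℝ 1 c) (hL : ∀ t ∈ Icc (0 : ℝ) 1, c t ∈ L2) :
    Real.arsinh (mink n (c 1)) - Real.arsinh (mink n (c 0)) ≤ curveLength c := by
  have hder (t : ℝ) := (hasDerivAt_mink (hasDerivAt_const t n)
    (hc.differentiable one_ne_zero t).hasDerivAt).arsinh
  refine intervalIntegral.sub_le_integral_of_hasDeriv_right_of_le zero_le_one
    (fun t _ => (hder t).continuousAt.continuousWithinAt) (fun t _ => (hder t).hasDerivWithinAt)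
    (continuous_speed hc).continuousOn.integrableOn_Icc fun t ht => ?_
  have cauchy_schwarz := mink_sq_le_of_unit (hL t (Ioo_subset_Icc_self ht)).1 hn
    (mink_deriv_eq_zero_of_mem_L2 hc hL ht)
  have sqrt_pos : 0 < Real.sqrt (1 + mink n (c t) ^ 2) := Real.sqrt_pos.2 (by positivity)
  rw [smul_eq_mul, inv_mul_le_iff₀ sqrt_pos, ← Real.sqrt_mul (by positivity)]
  refine Real.le_sqrt_of_sq_le ?_
  simpa [mink_eq] using cauchy_schwarz

theorem riemDist_eq {R S : L2} (h : R ≠ S) : riemDist R S = Real.arsinh (shDist R S) := by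
  have hp := isPair_of_ne h
  refine IsLeast.csInf_eq ⟨⟨fun t => geodesic R S (t * Real.arsinh (shDist R S)), ?_,
    fun t _ => hp.geodesic_mem R.2 _, ?_, ?_, ?_⟩, ?_⟩
  · unfold geodesic
    fun_prop
  · simp [geodesic]
  · simp only [one_mul, hp.geodesic_arsinh_shDist]
  · exact (hp.curveLength_geodesic (Real.arsinh_nonneg_iff.2 hp.shDist_pos.le)).symm
  · rintro _ ⟨c, hc, hL, h0, h1, rfl⟩
    have lower := arsinh_mink_sub_le_curveLength hp.mink_dir₁_dir₁ hc hL
    rwa [h0, h1, mink_comm _ (S : Fin 3 → ℝ), hp.mink_right_dir₁, mink_comm _ (R : Fin 3 → ℝ),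
      hp.mink_left_dir₁, Real.arsinh_zero, sub_zero] at lower

/-! ### The reduction map -/

/-- The value of the momentum of the body `a` on a tangent vector, in canonical coordinates. A
tangent vector of the hyperboloid is determined by its first two components; the formula extends the
covector to all of `ℝ³`. -/
def pair (y : Model) (a : Fin 2) : (Fin 3 → ℝ) →L[ℝ] ℝ :=
  y.2 (a, 0) • ContinuousLinearMap.proj 0 + y.2 (a, 1) • ContinuousLinearMap.proj 1

theorem pair_apply (y : Model) (a : Fin 2) (v : Fin 3 → ℝ) :
    pair y a v = y.2 (a, 0) * v 0 + y.2 (a, 1) * v 1 := rfl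

theorem pair_mk_single (x : Fin 2 × Fin 2 → ℝ) (i : Fin 2 × Fin 2) (a : Fin 2) (v : Fin 3 → ℝ) :
    pair (x, Pi.single i 1) a v = if i.1 = a then v i.2.castSucc else 0 := by
  obtain ⟨b, j⟩ := i
  fin_cases a <;> fin_cases b <;> fin_cases j <;> simp [pair_apply]

/-- The position of the body `a`, in canonical coordinates. -/
def pos (y : Model) (a : Fin 2) : Fin 3 → ℝ := lift fun j => y.1 (a, j)

theorem pos_coords (z : PhaseSpace) (a : Fin 2) : pos (coords z) a = z.R a :=
  congrArg Subtype.val (L2_ext (R := lift fun j => (coords z).1 (a, j)) (S := z.R a) rfl rfl)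

theorem covec_eq_pair (z : PhaseSpace) (a : Fin 2) (v : tangentL2 (z.R a)) :
    z.α a v = pair (coords z) a v := by
  conv_lhs => rw [tangent_eq (z.R a) v]
  simp only [map_add, map_smul, smul_eq_mul, pair_apply, coords]
  ring

theorem pair_smul_act (g : SO21) (z : PhaseSpace) (a : Fin 2) {v : Fin 3 → ℝ}
    (hv : v ∈ tangentL2 (z.R a)) : pair (coords (g • z)) a (act g v) = pair (coords z) a v := by
  have mem_image : act g v ∈ tangentL2 ((g • z).R a) := by
    rw [mem_tangentL2, smul_R, mink_act]
    exact hv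
  have mem_back : act g⁻¹ (act g v) ∈ tangentL2 (z.R a) := by rwa [act_inv_act]
  have h := smul_α g z a (act g v) mem_image mem_back
  rw [covec_eq_pair, covec_eq_pair] at h
  simpa only [act_inv_act] using h

/-- The angular momentum: the value of the momentum covector on the infinitesimal isometry
`v ↦ w × v`, as a function of `w`. -/
def angMom (y : Model) : (Fin 3 → ℝ) →L[ℝ] ℝ := ∑ a, pair y a ∘L mcross.flip (pos y a)

theorem angMom_apply (y : Model) (w : Fin 3 → ℝ) :
    angMom y w = pair y 0 (mcross w (pos y 0)) + pair y 1 (mcross w (pos y 1)) := by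
  simp [angMom, Fin.sum_univ_two]

/-- The reduction map in canonical coordinates: `m` consists of the components of the angular
momentum with respect to the moving frame, `q` is the distance of the bodies, and `p` is the
component of the momentum of the second body along the geodesic that joins them. -/
def reductionCoords (y : Model) : E5 :=
  (fun k => angMom y ((bodyFrame (pos y 0) (pos y 1)).col k),
    Real.arsinh (shDist (pos y 0) (pos y 1)), pair y 1 (dir₂ (pos y 0) (pos y 1)))

/-- The reduction map `T*Q → ℝ³ × (0, ∞) × ℝ`. -/
def reduction (z : PhaseSpace) : E5 := reductionCoords (coords z)

theorem reduction_fst_apply (z : PhaseSpace) (k : Fin 3) :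
    (reduction z).1 k =
      angMom (coords z) (![normal (z.R 0 : Fin 3 → ℝ) (z.R 1), -dir₁ (z.R 0 : Fin 3 → ℝ) (z.R 1),
        (z.R 0 : Fin 3 → ℝ)] k) := by
  simp only [reduction, reductionCoords, pos_coords]
  rfl

theorem reduction_snd_fst (z : PhaseSpace) :
    (reduction z).2.1 = Real.arsinh (shDist (z.R 0 : Fin 3 → ℝ) (z.R 1)) := by
  simp only [reduction, reductionCoords, pos_coords]

theorem reduction_snd_snd (z : PhaseSpace) :
    (reduction z).2.2 = pair (coords z) 1 (dir₂ (z.R 0 : Fin 3 → ℝ) (z.R 1)) := by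
  simp only [reduction, reductionCoords, pos_coords]

theorem reduction_mx (z : PhaseSpace) :
    (reduction z).1 0 = pair (coords z) 0 (dir₁ (z.R 0 : Fin 3 → ℝ) (z.R 1)) +
      pair (coords z) 1 (dir₂ (z.R 0 : Fin 3 → ℝ) (z.R 1)) := by
  rw [reduction_fst_apply, Matrix.cons_val_zero, angMom_apply, pos_coords, pos_coords,
    z.isPair.mcross_normal_left, z.isPair.mcross_normal_right]

theorem reduction_my (z : PhaseSpace) :
    (reduction z).1 1 = pair (coords z) 0 (normal (z.R 0 : Fin 3 → ℝ) (z.R 1)) +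
      chDist (z.R 0 : Fin 3 → ℝ) (z.R 1) *
        pair (coords z) 1 (normal (z.R 0 : Fin 3 → ℝ) (z.R 1)) := by
  rw [reduction_fst_apply, Matrix.cons_val_one, Matrix.cons_val_zero, angMom_apply, pos_coords,
    pos_coords, mcross_neg_left, mcross_neg_left, mcross_left_dir₁, z.isPair.mcross_right_dir₁,
    map_smul, smul_eq_mul]

theorem reduction_mz (z : PhaseSpace) :
    (reduction z).1 2 = shDist (z.R 0 : Fin 3 → ℝ) (z.R 1) *
      pair (coords z) 1 (normal (z.R 0 : Fin 3 → ℝ) (z.R 1)) := by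
  rw [reduction_fst_apply, Matrix.cons_val_two, Matrix.tail_cons, Matrix.head_cons, angMom_apply,
    pos_coords, pos_coords, mcross_self, map_zero, zero_add, z.isPair.mcross_left_right, map_smul,
    smul_eq_mul]

theorem angMom_act_frame (z : PhaseSpace) (w : Fin 3 → ℝ) :
    angMom (coords z) (act z.frame w) = (reduction z).1 ⬝ᵥ w := by
  rw [z.act_frame, dotProduct, Fin.sum_univ_three]
  simp only [reduction_fst_apply, Matrix.cons_val, map_add, map_sub, map_smul, map_neg, smul_eq_mul]
  ring

theorem reduction_mem (z : PhaseSpace) : reduction z ∈ reducedSet := by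
  change 0 < (reduction z).2.1
  rw [reduction_snd_fst]
  exact Real.arsinh_pos_iff.2 z.isPair.shDist_pos

theorem qCoord_reduction (z : PhaseSpace) : qCoord (reduction z) = riemDist (z.R 0) (z.R 1) := by
  rw [riemDist_eq z.ne]
  exact reduction_snd_fst z

theorem reduction_smul (g : SO21) (z : PhaseSpace) : reduction (g • z) = reduction z := by
  have h := z.isPair
  refine Prod.ext (funext fun k => ?_) (Prod.ext ?_ ?_)
  · fin_cases k
    · change (reduction (g • z)).1 0 = (reduction z).1 0
      rw [reduction_mx, reduction_mx, smul_R, smul_R, dir₁_act, dir₂_act,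
        pair_smul_act g z 0 h.mink_left_dir₁, pair_smul_act g z 1 h.mink_right_dir₂]
    · change (reduction (g • z)).1 1 = (reduction z).1 1
      rw [reduction_my, reduction_my, smul_R, smul_R, chDist_act, normal_act,
        pair_smul_act g z 0 (mink_left_normal _ _), pair_smul_act g z 1 (mink_right_normal _ _)]
    · change (reduction (g • z)).1 2 = (reduction z).1 2
      rw [reduction_mz, reduction_mz, smul_R, smul_R, shDist_act, normal_act,
        pair_smul_act g z 1 (mink_right_normal _ _)]
  · rw [reduction_snd_fst, reduction_snd_fst, smul_R, smul_R, shDist_act]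
  · rw [reduction_snd_snd, reduction_snd_snd, smul_R, smul_R, dir₂_act,
      pair_smul_act g z 1 h.mink_right_dir₂]

/-! ### Smoothness of the reduction map -/

theorem contDiff_pos (a : Fin 2) : ContDiff ℝ ∞ fun y : Model => pos y a := by
  refine contDiff_pi.2 fun i => ?_
  fin_cases i
  · change ContDiff ℝ ∞ fun y : Model => y.1 (a, 0)
    fun_prop
  · change ContDiff ℝ ∞ fun y : Model => y.1 (a, 1)
    fun_prop
  · change ContDiff ℝ ∞ fun y : Model => Real.sqrt (1 + y.1 (a, 0) ^ 2 + y.1 (a, 1) ^ 2)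
    exact ContDiff.sqrt (by fun_prop) fun y => by positivity

theorem contDiff_chDist : ContDiff ℝ ∞ fun y : Model => chDist (pos y 0) (pos y 1) := by
  simp only [chDist, ← minkCLM_apply]
  exact ((minkCLM.contDiff.comp (contDiff_pos 0)).clm_apply (contDiff_pos 1)).neg

theorem isPair_pos (z : PhaseSpace) : IsPair (pos (coords z) 0) (pos (coords z) 1) := by
  rw [pos_coords, pos_coords]
  exact z.isPair

theorem contDiffAt_shDist (z : PhaseSpace) :
    ContDiffAt ℝ ∞ (fun y : Model => shDist (pos y 0) (pos y 1)) (coords z) :=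
  ((contDiff_chDist.contDiffAt.pow 2).sub contDiffAt_const).sqrt
    (isPair_pos z).chDist_sq_sub_one_pos.ne'

theorem contDiffAt_inv_shDist (z : PhaseSpace) :
    ContDiffAt ℝ ∞ (fun y : Model => (shDist (pos y 0) (pos y 1))⁻¹) (coords z) :=
  (contDiffAt_shDist z).inv (isPair_pos z).shDist_ne_zero

theorem contDiffAt_dir₁ (z : PhaseSpace) :
    ContDiffAt ℝ ∞ (fun y : Model => dir₁ (pos y 0) (pos y 1)) (coords z) :=
  (contDiffAt_inv_shDist z).smul
    ((contDiff_pos 1).sub (contDiff_chDist.smul (contDiff_pos 0))).contDiffAt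

theorem contDiffAt_dir₂ (z : PhaseSpace) :
    ContDiffAt ℝ ∞ (fun y : Model => dir₂ (pos y 0) (pos y 1)) (coords z) :=
  (contDiffAt_inv_shDist z).smul
    ((contDiff_chDist.smul (contDiff_pos 1)).sub (contDiff_pos 0)).contDiffAt

theorem contDiffAt_normal (z : PhaseSpace) :
    ContDiffAt ℝ ∞ (fun y : Model => normal (pos y 0) (pos y 1)) (coords z) :=
  (contDiffAt_inv_shDist z).smul
    ((mcross.contDiff.comp (contDiff_pos 0)).clm_apply (contDiff_pos 1)).contDiffAt

theorem contDiffAt_pair {y : Model} {F : Model → Fin 3 → ℝ} (hF : ContDiffAt ℝ ∞ F y)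
    (a : Fin 2) : ContDiffAt ℝ ∞ (fun y : Model => pair y a (F y)) y := by
  have h := contDiffAt_pi.1 hF
  simp only [pair_apply]
  fun_prop

theorem contDiffAt_angMom {y : Model} {F : Model → Fin 3 → ℝ} (hF : ContDiffAt ℝ ∞ F y) :
    ContDiffAt ℝ ∞ (fun y : Model => angMom y (F y)) y := by
  have contDiffAt_mcross : ∀ a, ContDiffAt ℝ ∞ (fun y : Model => mcross (F y) (pos y a)) y :=
    fun a => (mcross.contDiff.contDiffAt.comp y hF).clm_apply (contDiff_pos a).contDiffAt
  simp only [angMom_apply]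
  exact (contDiffAt_pair (contDiffAt_mcross 0) 0).add (contDiffAt_pair (contDiffAt_mcross 1) 1)

theorem contDiffAt_reductionCoords (z : PhaseSpace) :
    ContDiffAt ℝ ∞ reductionCoords (coords z) := by
  refine ContDiffAt.prodMk (contDiffAt_pi.2 fun k => contDiffAt_angMom ?_)
    ((contDiffAt_shDist z).arsinh.prodMk (contDiffAt_pair (contDiffAt_dir₂ z) 1))
  fin_cases k
  · exact contDiffAt_normal z
  · exact (contDiffAt_dir₁ z).neg
  · exact (contDiff_pos 0).contDiffAt

theorem differentiableAt_reductionCoords (z : PhaseSpace) :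
    DifferentiableAt ℝ reductionCoords (coords z) :=
  (contDiffAt_reductionCoords z).differentiableAt (by simp)

/-! ### The derivative of the moving frame -/

theorem mink_mcross_skew (u v w : Fin 3 → ℝ) :
    mink (mcross u v) w + mink v (mcross u w) = 0 := by
  rw [mcross_eq, mcross_eq, mink_eq, mink_eq]
  simp only [Matrix.cons_val]
  ring

section MovingFrame

variable {r₀ r₁ : ℝ → Fin 3 → ℝ} {w : Fin 3 → ℝ} {l t : ℝ}

theorem hasDerivAt_chDist (h : IsPair (r₀ t) (r₁ t)) (h₀ : HasDerivAt r₀ (mcross w (r₀ t)) t)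
    (h₁ : HasDerivAt r₁ (mcross w (r₁ t) + l • dir₂ (r₀ t) (r₁ t)) t) :
    HasDerivAt (fun t => chDist (r₀ t) (r₁ t)) (l * shDist (r₀ t) (r₁ t)) t := by
  refine (hasDerivAt_mink h₀ h₁).neg.congr_deriv ?_
  rw [mink_add_right, mink_smul_right, h.mink_left_dir₂]
  linear_combination -mink_mcross_skew w (r₀ t) (r₁ t)

theorem hasDerivAt_shDist (h : IsPair (r₀ t) (r₁ t)) (h₀ : HasDerivAt r₀ (mcross w (r₀ t)) t)
    (h₁ : HasDerivAt r₁ (mcross w (r₁ t) + l • dir₂ (r₀ t) (r₁ t)) t) :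
    HasDerivAt (fun t => shDist (r₀ t) (r₁ t)) (l * chDist (r₀ t) (r₁ t)) t := by
  refine (((hasDerivAt_chDist h h₀ h₁).pow 2).sub_const 1).sqrt
    h.chDist_sq_sub_one_pos.ne' |>.congr_deriv ?_
  change _ / (2 * shDist (r₀ t) (r₁ t)) = _
  have := h.shDist_ne_zero
  field_simp
  push_cast
  ring

theorem hasDerivAt_inv_shDist_smul {F : ℝ → Fin 3 → ℝ} {G : Fin 3 → ℝ} (h : IsPair (r₀ t) (r₁ t))
    (h₀ : HasDerivAt r₀ (mcross w (r₀ t)) t)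
    (h₁ : HasDerivAt r₁ (mcross w (r₁ t) + l • dir₂ (r₀ t) (r₁ t)) t)
    (hF : HasDerivAt F (shDist (r₀ t) (r₁ t) • G +
      (l * chDist (r₀ t) (r₁ t)) • (shDist (r₀ t) (r₁ t))⁻¹ • F t) t) :
    HasDerivAt (fun t => (shDist (r₀ t) (r₁ t))⁻¹ • F t) G t := by
  refine (((hasDerivAt_shDist h h₀ h₁).inv h.shDist_ne_zero).smul hF).congr_deriv ?_
  have := h.shDist_ne_zero
  ext i
  simp only [Pi.add_apply, Pi.smul_apply, smul_eq_mul, Pi.inv_apply]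
  field_simp
  ring

theorem hasDerivAt_dir₁ (h : IsPair (r₀ t) (r₁ t)) (h₀ : HasDerivAt r₀ (mcross w (r₀ t)) t)
    (h₁ : HasDerivAt r₁ (mcross w (r₁ t) + l • dir₂ (r₀ t) (r₁ t)) t) :
    HasDerivAt (fun t => dir₁ (r₀ t) (r₁ t)) (mcross w (dir₁ (r₀ t) (r₁ t))) t := by
  have shDist_smul_mcross : shDist (r₀ t) (r₁ t) • mcross w (dir₁ (r₀ t) (r₁ t)) =
      mcross w (r₁ t) - chDist (r₀ t) (r₁ t) • mcross w (r₀ t) := by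
    rw [← map_smul, h.shDist_smul_dir₁, map_sub, map_smul]
  refine hasDerivAt_inv_shDist_smul h h₀ h₁
    ((h₁.sub ((hasDerivAt_chDist h h₀ h₁).smul h₀)).congr_deriv ?_)
  change _ = _ + _ • dir₁ (r₀ t) (r₁ t)
  rw [shDist_smul_mcross, h.dir₂_eq]
  module

theorem hasDerivAt_dir₂ (h : IsPair (r₀ t) (r₁ t)) (h₀ : HasDerivAt r₀ (mcross w (r₀ t)) t)
    (h₁ : HasDerivAt r₁ (mcross w (r₁ t) + l • dir₂ (r₀ t) (r₁ t)) t) :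
    HasDerivAt (fun t => dir₂ (r₀ t) (r₁ t)) (mcross w (dir₂ (r₀ t) (r₁ t)) + l • r₁ t) t := by
  have shDist_smul_mcross : shDist (r₀ t) (r₁ t) • mcross w (dir₂ (r₀ t) (r₁ t)) =
      chDist (r₀ t) (r₁ t) • mcross w (r₁ t) - mcross w (r₀ t) := by
    rw [← map_smul, h.shDist_smul_dir₂, map_sub, map_smul]
  refine hasDerivAt_inv_shDist_smul h h₀ h₁
    ((((hasDerivAt_chDist h h₀ h₁).smul h₁).sub h₀).congr_deriv ?_)
  change _ = _ + _ • dir₂ (r₀ t) (r₁ t)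
  rw [smul_add, smul_add, shDist_smul_mcross]
  module

theorem hasDerivAt_normal (h : IsPair (r₀ t) (r₁ t)) (h₀ : HasDerivAt r₀ (mcross w (r₀ t)) t)
    (h₁ : HasDerivAt r₁ (mcross w (r₁ t) + l • dir₂ (r₀ t) (r₁ t)) t) :
    HasDerivAt (fun t => normal (r₀ t) (r₁ t)) (mcross w (normal (r₀ t) (r₁ t))) t := by
  refine hasDerivAt_inv_shDist_smul h h₀ h₁ ((hasDerivAt_mcross h₀ h₁).congr_deriv ?_)
  change _ = _ + _ • normal (r₀ t) (r₁ t)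
  rw [map_add, ← add_assoc, ← mcross_leibniz, h.mcross_left_right, map_smul, map_smul,
    h.mcross_left_dir₂, smul_smul]

theorem hasDerivAt_bodyFrame_col (h : IsPair (r₀ t) (r₁ t))
    (h₀ : HasDerivAt r₀ (mcross w (r₀ t)) t)
    (h₁ : HasDerivAt r₁ (mcross w (r₁ t) + l • dir₂ (r₀ t) (r₁ t)) t) (k : Fin 3) :
    HasDerivAt (fun t => (bodyFrame (r₀ t) (r₁ t)).col k)
      (mcross w ((bodyFrame (r₀ t) (r₁ t)).col k)) t := by
  fin_cases k
  · exact hasDerivAt_normal h h₀ h₁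
  · exact (hasDerivAt_dir₁ h h₀ h₁).neg.congr_deriv (map_neg _ _).symm
  · exact h₀

theorem hasDerivAt_arsinh_shDist (h : IsPair (r₀ t) (r₁ t))
    (h₀ : HasDerivAt r₀ (mcross w (r₀ t)) t)
    (h₁ : HasDerivAt r₁ (mcross w (r₁ t) + l • dir₂ (r₀ t) (r₁ t)) t) :
    HasDerivAt (fun t => Real.arsinh (shDist (r₀ t) (r₁ t))) l t := by
  refine (hasDerivAt_shDist h h₀ h₁).arsinh.congr_deriv ?_
  rw [← Real.cosh_arsinh, h.cosh_arsinh_shDist, smul_eq_mul, mul_comm l,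
    inv_mul_cancel_left₀ h.chDist_ne_zero]

end MovingFrame

/-! ### The derivative of the reduction map -/

theorem dotProduct_apply_col (M : Matrix (Fin 3) (Fin 3) ℝ) (L : (Fin 3 → ℝ) →L[ℝ] ℝ)
    (c : Fin 3 → ℝ) : (fun k => L (M.col k)) ⬝ᵥ c = L (M *ᵥ c) := by
  rw [Matrix.mulVec_eq_sum, map_sum, dotProduct]
  exact Finset.sum_congr rfl fun k _ => by
    rw [op_smul_eq_smul, map_smul, smul_eq_mul, mul_comm]
    rfl

/-- The direction in the space of canonical coordinates in which the bodies move with the velocities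
`v` and the canonical momenta do not change. -/
def velocityDir (v : Fin 2 → Fin 3 → ℝ) : Model := (fun i => v i.1 i.2.castSucc, 0)

/-- The velocities of the bodies when the pair rotates with the angular velocity `w` and the second
body moves away from the first one with the speed `l`. -/
def velocity (z : PhaseSpace) (w : Fin 3 → ℝ) (l : ℝ) : Fin 2 → Fin 3 → ℝ :=
  ![mcross w (z.R 0), mcross w (z.R 1) + l • dir₂ (z.R 0 : Fin 3 → ℝ) (z.R 1)]

theorem velocity_mem (z : PhaseSpace) (w : Fin 3 → ℝ) (l : ℝ) (a : Fin 2) :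
    velocity z w l a ∈ tangentL2 (z.R a) := by
  rw [mem_tangentL2]
  fin_cases a
  · exact mink_mcross_right w _
  · change mink (z.R 1) (mcross w (z.R 1) + l • _) = 0
    rw [mink_add_right, mink_mcross_right, mink_smul_right, z.isPair.mink_right_dir₂, mul_zero,
      add_zero]

theorem hasDerivAt_sqrt_one_add_sq_add_sq {x₀ x₁ : ℝ → ℝ} {v₀ v₁ t : ℝ} (h₀ : HasDerivAt x₀ v₀ t)
    (h₁ : HasDerivAt x₁ v₁ t) :
    HasDerivAt (fun t => Real.sqrt (1 + x₀ t ^ 2 + x₁ t ^ 2))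
      ((x₀ t * v₀ + x₁ t * v₁) / Real.sqrt (1 + x₀ t ^ 2 + x₁ t ^ 2)) t := by
  have pos : 0 < 1 + x₀ t ^ 2 + x₁ t ^ 2 := by positivity
  refine ((((h₀.pow 2).const_add 1).add (h₁.pow 2)).sqrt pos.ne').congr_deriv ?_
  change _ / (2 * Real.sqrt (1 + x₀ t ^ 2 + x₁ t ^ 2)) = _
  have := (Real.sqrt_pos.2 pos).ne'
  field_simp
  push_cast
  ring

theorem hasDerivAt_pos {z : PhaseSpace} {v : Fin 2 → Fin 3 → ℝ} (a : Fin 2)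
    (hv : v a ∈ tangentL2 (z.R a)) :
    HasDerivAt (fun t : ℝ => pos (coords z + t • velocityDir v) a) (v a) 0 := by
  have hasDerivAt_line (j : Fin 2) :
      HasDerivAt (fun t : ℝ => (coords z + t • velocityDir v).1 (a, j)) (v a j.castSucc) 0 :=
    (((hasDerivAt_id (0 : ℝ)).mul_const (v a j.castSucc)).const_add _).congr_deriv (one_mul _)
  have pos_zero (i : Fin 3) :
      pos (coords z + (0 : ℝ) • velocityDir v) a i = (z.R a : Fin 3 → ℝ) i := by
    rw [zero_smul, add_zero, pos_coords]
  refine hasDerivAt_pi.2 fun i => ?_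
  fin_cases i
  · exact hasDerivAt_line 0
  · exact hasDerivAt_line 1
  · refine (hasDerivAt_sqrt_one_add_sq_add_sq (hasDerivAt_line 0)
      (hasDerivAt_line 1)).congr_deriv ?_
    have tangent : mink (z.R a) (v a) = 0 := hv
    rw [mink_eq] at tangent
    refine (div_eq_iff ((pos_zero 2).trans_ne (z.R a).2.2.ne')).2 ?_
    change pos (coords z + (0 : ℝ) • velocityDir v) a 0 * v a 0 +
      pos (coords z + (0 : ℝ) • velocityDir v) a 1 * v a 1 =
        v a 2 * pos (coords z + (0 : ℝ) • velocityDir v) a 2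
    rw [pos_zero, pos_zero, pos_zero]
    linarith

theorem hasDerivAt_reductionCoords_velocityDir (z : PhaseSpace) (w : Fin 3 → ℝ) (l : ℝ) :
    HasDerivAt (fun t : ℝ => reductionCoords (coords z + t • velocityDir (velocity z w l)))
      (fun k => pair (coords z) 0
            (mcross w (mcross ((bodyFrame (z.R 0) (z.R 1)).col k) (z.R 0))) +
          pair (coords z) 1 (mcross w (mcross ((bodyFrame (z.R 0) (z.R 1)).col k) (z.R 1)) +
            l • mcross ((bodyFrame (z.R 0) (z.R 1)).col k) (dir₂ (z.R 0 : Fin 3 → ℝ) (z.R 1))),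
        l, pair (coords z) 1 (mcross w (dir₂ (z.R 0 : Fin 3 → ℝ) (z.R 1)) +
          l • (z.R 1 : Fin 3 → ℝ))) 0 := by
  let y : ℝ → Model := fun t => coords z + t • velocityDir (velocity z w l)
  have pos_zero (a : Fin 2) : pos (y 0) a = z.R a := by
    change pos (coords z + (0 : ℝ) • velocityDir (velocity z w l)) a = z.R a
    rw [zero_smul, add_zero, pos_coords]
  have pair_const (t : ℝ) (a : Fin 2) : pair (y t) a = pair (coords z) a := by
    ext v
    simp [pair_apply, y, velocityDir]
  have h : IsPair (pos (y 0) 0) (pos (y 0) 1) := by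
    rw [pos_zero, pos_zero]
    exact z.isPair
  have h₀ : HasDerivAt (fun t => pos (y t) 0) (mcross w (pos (y 0) 0)) 0 := by
    rw [pos_zero]
    exact hasDerivAt_pos 0 (velocity_mem z w l 0)
  have h₁ : HasDerivAt (fun t => pos (y t) 1)
      (mcross w (pos (y 0) 1) + l • dir₂ (pos (y 0) 0) (pos (y 0) 1)) 0 := by
    rw [pos_zero, pos_zero]
    exact hasDerivAt_pos 1 (velocity_mem z w l 1)
  have hcol := hasDerivAt_bodyFrame_col h h₀ h₁
  change HasDerivAt (fun t => reductionCoords (y t)) _ 0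
  simp only [reductionCoords, angMom_apply, pair_const]
  rw [← pos_zero 0, ← pos_zero 1]
  refine (hasDerivAt_pi.2 fun k => ?_).prodMk ((hasDerivAt_arsinh_shDist h h₀ h₁).prodMk
    ((pair (coords z) 1).hasFDerivAt.comp_hasDerivAt 0 (hasDerivAt_dir₂ h h₀ h₁)))
  refine (((pair (coords z) 0).hasFDerivAt.comp_hasDerivAt 0
    (hasDerivAt_mcross (hcol k) h₀)).add ((pair (coords z) 1).hasFDerivAt.comp_hasDerivAt 0
    (hasDerivAt_mcross (hcol k) h₁))).congr_deriv ?_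
  rw [mcross_leibniz w, mcross_leibniz w, map_add (mcross _), map_smul (mcross _), add_assoc]

theorem apply_fderiv_reductionCoords_velocityDir (z : PhaseSpace) (w : Fin 3 → ℝ) (l : ℝ)
    (α : E5 →L[ℝ] ℝ) :
    α (fderiv ℝ reductionCoords (coords z) (velocityDir (velocity z w l))) =
      pair (coords z) 0 (mcross w (mcross (act z.frame (covecGrad α)) (z.R 0))) +
        pair (coords z) 1 (mcross w (mcross (act z.frame (covecGrad α)) (z.R 1))) +
        l * pair (coords z) 1
          (mcross (act z.frame (covecGrad α)) (dir₂ (z.R 0 : Fin 3 → ℝ) (z.R 1))) +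
        l * α (0, 1, 0) +
        pair (coords z) 1 (mcross w (dir₂ (z.R 0 : Fin 3 → ℝ) (z.R 1)) +
          l • (z.R 1 : Fin 3 → ℝ)) * α (0, 0, 1) := by
  have fderiv_eq := (differentiableAt_reductionCoords z).hasFDerivAt.hasLineDerivAt
    (velocityDir (velocity z w l)) |>.unique (hasDerivAt_reductionCoords_velocityDir z w l)
  let L : (Fin 3 → ℝ) →L[ℝ] ℝ := pair (coords z) 0 ∘L mcross w ∘L mcross.flip (z.R 0) +
    pair (coords z) 1 ∘L (mcross w ∘L mcross.flip (z.R 1) +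
      l • mcross.flip (dir₂ (z.R 0 : Fin 3 → ℝ) (z.R 1)))
  have dot_eq := dotProduct_apply_col (bodyFrame (z.R 0) (z.R 1)) L (covecGrad α)
  rw [fderiv_eq, covec_apply]
  refine congrArg₂ _ (congrArg₂ _ (dot_eq.trans ?_) rfl) rfl
  change pair _ 0 _ + pair _ 1 (_ + l • _) = _
  rw [map_add, map_smul, smul_eq_mul, ← add_assoc]
  rfl

theorem reductionCoords_add_smul_momentum (z : PhaseSpace) (ξ : Fin 2 × Fin 2 → ℝ) (t : ℝ) :
    reductionCoords (coords z + t • ((0, ξ) : Model)) = reductionCoords (coords z) +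
      t • ((fun k => angMom ((coords z).1, ξ) ((bodyFrame (z.R 0) (z.R 1)).col k), 0,
        pair ((coords z).1, ξ) 1 (dir₂ (z.R 0 : Fin 3 → ℝ) (z.R 1))) : E5) := by
  have pos_base (a : Fin 2) : pos ((coords z).1, ξ) a = z.R a := pos_coords z a
  have pos_line (a : Fin 2) : pos (coords z + t • ((0, ξ) : Model)) a = z.R a := by
    rw [← pos_coords]
    simp only [pos, Prod.fst_add, Prod.smul_fst, smul_zero, add_zero]
  have pair_line (a : Fin 2) (v : Fin 3 → ℝ) : pair (coords z + t • ((0, ξ) : Model)) a v =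
      pair (coords z) a v + t * pair ((coords z).1, ξ) a v := by
    simp only [pair_apply, Prod.snd_add, Prod.smul_snd, Pi.add_apply, Pi.smul_apply, smul_eq_mul]
    ring
  refine Prod.ext (funext fun k => ?_) (Prod.ext ?_ ?_)
  · simp only [reductionCoords, angMom_apply, pos_line, pos_coords, pos_base, pair_line,
      Prod.fst_add, Prod.smul_fst, Pi.add_apply, Pi.smul_apply, smul_eq_mul]
    ring
  · simp only [reductionCoords, pos_line, pos_coords, Prod.snd_add, Prod.fst_add,
      Prod.smul_snd, Prod.smul_fst, smul_zero, add_zero]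
  · simp only [reductionCoords, pos_line, pos_coords, pair_line, Prod.snd_add,
      Prod.smul_snd, smul_eq_mul]

theorem fderiv_reductionCoords_momentum (z : PhaseSpace) (ξ : Fin 2 × Fin 2 → ℝ) :
    fderiv ℝ reductionCoords (coords z) (0, ξ) =
      (fun k => angMom ((coords z).1, ξ) ((bodyFrame (z.R 0) (z.R 1)).col k), 0,
        pair ((coords z).1, ξ) 1 (dir₂ (z.R 0 : Fin 3 → ℝ) (z.R 1))) := by
  refine ((differentiableAt_reductionCoords z).hasFDerivAt.hasLineDerivAt (0, ξ)).unique ?_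
  refine HasDerivAt.congr_of_eventuallyEq ?_
    (.of_forall (reductionCoords_add_smul_momentum z ξ))
  exact (((hasDerivAt_id (0 : ℝ)).smul_const _).const_add _).congr_deriv (one_smul _ _)

theorem apply_fderiv_reductionCoords_momentum (z : PhaseSpace) (ξ : Fin 2 × Fin 2 → ℝ)
    (α : E5 →L[ℝ] ℝ) :
    α (fderiv ℝ reductionCoords (coords z) (0, ξ)) = ∑ a, pair ((coords z).1, ξ) a
      (velocity z (act z.frame (covecGrad α)) (α (0, 0, 1)) a) := by
  rw [fderiv_reductionCoords_momentum, covec_apply, dotProduct_apply_col, Fin.sum_univ_two]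
  have pos_base (a : Fin 2) : pos ((coords z).1, ξ) a = z.R a := pos_coords z a
  change angMom _ (act z.frame (covecGrad α)) + 0 * _ + _ = pair _ 0 (mcross _ _) +
    pair _ 1 (mcross _ _ + _ • _)
  rw [angMom_apply, pos_base, pos_base, map_add, map_smul, smul_eq_mul]
  ring

/-! ### The reduction map is a Poisson map -/

theorem coords_symm {y : Model} (hy : y ∈ range coords) :
    coords ((isOpenEmbedding_coords.toOpenPartialHomeomorph coords).symm y) = y :=
  IsOpenEmbedding.toOpenPartialHomeomorph_right_inv _ _ hy

theorem symm_coords (z : PhaseSpace) :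
    (isOpenEmbedding_coords.toOpenPartialHomeomorph coords).symm (coords z) = z :=
  IsOpenEmbedding.toOpenPartialHomeomorph_left_inv _ _

theorem reduction_comp_symm_eventuallyEq (z : PhaseSpace) :
    reduction ∘ (isOpenEmbedding_coords.toOpenPartialHomeomorph coords).symm =ᶠ[𝓝 (coords z)]
      reductionCoords := by
  filter_upwards [isOpenEmbedding_coords.isOpen_range.mem_nhds (mem_range_self z)] with y hy
  simp only [Function.comp_apply, reduction, coords_symm hy]

theorem coordDeriv_comp_reduction {F : E5 → ℝ} {z : PhaseSpace}
    (hF : DifferentiableAt ℝ F (reduction z)) :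
    coordDeriv (F ∘ reduction) z =
      fderiv ℝ F (reduction z) ∘L fderiv ℝ reductionCoords (coords z) := by
  rw [coordDeriv, Function.comp_assoc, ((reduction_comp_symm_eventuallyEq z).fun_comp F).fderiv_eq]
  exact fderiv_comp _ hF (differentiableAt_reductionCoords z)

theorem dmom_comp_reduction {F : E5 → ℝ} {z : PhaseSpace}
    (hF : DifferentiableAt ℝ F (reduction z)) :
    ((fun i => dmom i (F ∘ reduction) z, 0) : Model) =
      velocityDir (velocity z (act z.frame (gradm F (reduction z))) (dp F (reduction z))) := by
  refine Prod.ext (funext fun i => ?_) rfl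
  change coordDeriv (F ∘ reduction) z (0, Pi.single i 1) = velocity z _ _ i.1 i.2.castSucc
  rw [coordDeriv_comp_reduction hF, ContinuousLinearMap.comp_apply,
    apply_fderiv_reductionCoords_momentum]
  simp only [pair_mk_single, Finset.sum_ite_eq, Finset.mem_univ, if_true]
  rfl

/-- The Hamiltonian vector field of `f` in canonical coordinates. -/
def hamiltonianDir (f : PhaseSpace → ℝ) (z : PhaseSpace) : Model :=
  (fun i => dmom i f z, fun i => -dpos i f z)

theorem sum_smul_single (x ξ : Fin 2 × Fin 2 → ℝ) :
    ∑ i, (x i • ((Pi.single i 1, 0) : Model) + ξ i • ((0, Pi.single i 1) : Model)) = (x, ξ) := by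
  refine Prod.ext (funext fun j => ?_) (funext fun j => ?_)
  · simp [Prod.fst_sum, Finset.sum_apply, Pi.single_apply]
  · simp [Prod.snd_sum, Finset.sum_apply, Pi.single_apply]

theorem coordDeriv_apply (f : PhaseSpace → ℝ) (z : PhaseSpace) (x ξ : Fin 2 × Fin 2 → ℝ) :
    coordDeriv f z (x, ξ) = ∑ i, (x i * dpos i f z + ξ i * dmom i f z) := by
  rw [← sum_smul_single x ξ, map_sum]
  exact Finset.sum_congr rfl fun i _ => by rw [map_add, map_smul, map_smul]; rfl

theorem coordDeriv_hamiltonianDir (f g : PhaseSpace → ℝ) (z : PhaseSpace) :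
    coordDeriv f z (hamiltonianDir g z) = canonicalBracket f g z := by
  rw [hamiltonianDir, coordDeriv_apply, canonicalBracket]
  exact Finset.sum_congr rfl fun i _ => by ring

theorem canonicalBracket_eq_coordDeriv_sub (f g : PhaseSpace → ℝ) (z : PhaseSpace) :
    canonicalBracket f g z = coordDeriv f z (fun i => dmom i g z, 0) -
      coordDeriv g z (fun i => dmom i f z, 0) := by
  rw [coordDeriv_apply, coordDeriv_apply, canonicalBracket, ← Finset.sum_sub_distrib]
  exact Finset.sum_congr rfl fun i _ => by simp only [Pi.zero_apply]; ring

theorem reducedBracket_eq_mcross (f g : E5 → ℝ) (x : E5) :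
    reducedBracket f g x =
      x.1 ⬝ᵥ mcross (gradm g x) (gradm f x) + dq f x * dp g x - dp f x * dq g x := by
  simp only [reducedBracket, mcross_eq, vec3_dotProduct, Matrix.cons_val]
  ring

theorem apply_fderiv_reductionCoords_velocityDir_sub (z : PhaseSpace) (α β : E5 →L[ℝ] ℝ) :
    α (fderiv ℝ reductionCoords (coords z)
        (velocityDir (velocity z (act z.frame (covecGrad β)) (β (0, 0, 1))))) -
      β (fderiv ℝ reductionCoords (coords z)
        (velocityDir (velocity z (act z.frame (covecGrad α)) (α (0, 0, 1))))) =
      (reduction z).1 ⬝ᵥ mcross (covecGrad β) (covecGrad α) +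
        α (0, 1, 0) * β (0, 0, 1) - α (0, 0, 1) * β (0, 1, 0) := by
  rw [apply_fderiv_reductionCoords_velocityDir, apply_fderiv_reductionCoords_velocityDir,
    ← angMom_act_frame, ← mcross_act, angMom_apply, pos_coords, pos_coords]
  generalize act z.frame (covecGrad α) = φ
  generalize act z.frame (covecGrad β) = ψ
  rw [mcross_leibniz ψ φ, mcross_leibniz ψ φ]
  simp only [map_add, map_smul, smul_eq_mul]
  ring

theorem canonicalBracket_comp_reduction {F G : E5 → ℝ} {z : PhaseSpace}
    (hF : DifferentiableAt ℝ F (reduction z)) (hG : DifferentiableAt ℝ G (reduction z)) :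
    canonicalBracket (F ∘ reduction) (G ∘ reduction) z = reducedBracket F G (reduction z) := by
  rw [canonicalBracket_eq_coordDeriv_sub, dmom_comp_reduction hF, dmom_comp_reduction hG,
    coordDeriv_comp_reduction hF, coordDeriv_comp_reduction hG, reducedBracket_eq_mcross]
  exact apply_fderiv_reductionCoords_velocityDir_sub z _ _

theorem fderiv_reductionCoords_hamiltonianDir {H : E5 → ℝ} {z : PhaseSpace}
    (hH : DifferentiableAt ℝ H (reduction z)) :
    fderiv ℝ reductionCoords (coords z) (hamiltonianDir (H ∘ reduction) z) =
      reducedVectorField H (reduction z) := by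
  have apply_eq (L : E5 →L[ℝ] ℝ) :
      L (fderiv ℝ reductionCoords (coords z) (hamiltonianDir (H ∘ reduction) z)) =
        reducedBracket L H (reduction z) := by
    rw [← canonicalBracket_comp_reduction L.differentiableAt hH, ← coordDeriv_hamiltonianDir,
      coordDeriv_comp_reduction L.differentiableAt, L.fderiv, ContinuousLinearMap.comp_apply]
  exact Prod.ext (funext fun a => apply_eq (mCoordL a))
    (Prod.ext (apply_eq qCoordL) (apply_eq pCoordL))

theorem hasDerivAt_reduction_comp {H : E5 → ℝ} {c : ℝ → PhaseSpace} {t : ℝ}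
    (hH : DifferentiableAt ℝ H (reduction (c t))) (hc : HamiltonEqAt (H ∘ reduction) c t) :
    HasDerivAt (reduction ∘ c) (reducedVectorField H (reduction (c t))) t :=
  ((differentiableAt_reductionCoords (c t)).hasFDerivAt.comp_hasDerivAt t hc).congr_deriv
    (fderiv_reductionCoords_hamiltonianDir hH)

/-! ### Separation of the orbits -/

namespace PhaseSpace

variable (z : PhaseSpace)

/-- The unit tangent vectors at the two bodies of the geodesic that leads from the first body to the
second one. -/
def unitTangent : Fin 2 → Fin 3 → ℝ :=
  ![dir₁ (z.R 0 : Fin 3 → ℝ) (z.R 1), dir₂ (z.R 0 : Fin 3 → ℝ) (z.R 1)]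

/-- The unit normal vector of the geodesic through the two bodies. -/
def unitNormal : Fin 3 → ℝ := normal (z.R 0 : Fin 3 → ℝ) (z.R 1)

theorem unitTangent_mem (a : Fin 2) : z.unitTangent a ∈ tangentL2 (z.R a) := by
  fin_cases a
  exacts [z.isPair.mink_left_dir₁, z.isPair.mink_right_dir₂]

theorem unitNormal_mem (a : Fin 2) : z.unitNormal ∈ tangentL2 (z.R a) := by
  fin_cases a
  exacts [mink_left_normal _ _, mink_right_normal _ _]

theorem mink_unitTangent_unitTangent (a : Fin 2) :
    mink (z.unitTangent a) (z.unitTangent a) = 1 := by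
  fin_cases a
  exacts [z.isPair.mink_dir₁_dir₁, z.isPair.mink_dir₂_dir₂]

theorem mink_unitNormal_unitNormal : mink z.unitNormal z.unitNormal = 1 :=
  z.isPair.mink_normal_normal

theorem mink_unitTangent_unitNormal (a : Fin 2) : mink (z.unitTangent a) z.unitNormal = 0 := by
  fin_cases a
  exacts [mink_dir₁_normal _ _, mink_dir₂_normal _ _]

variable {z} in
theorem eq_add_of_mem_tangentL2 {a : Fin 2} {v : Fin 3 → ℝ} (hv : v ∈ tangentL2 (z.R a)) :
    v = mink v (z.unitTangent a) • z.unitTangent a + mink v z.unitNormal • z.unitNormal := by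
  fin_cases a
  exacts [z.isPair.tangent_left hv, z.isPair.tangent_right hv]

theorem sinh_reduction :
    Real.sinh (reduction z).2.1 = shDist (z.R 0 : Fin 3 → ℝ) (z.R 1) := by
  rw [reduction_snd_fst, Real.sinh_arsinh]

theorem cosh_reduction :
    Real.cosh (reduction z).2.1 = chDist (z.R 0 : Fin 3 → ℝ) (z.R 1) := by
  rw [reduction_snd_fst, z.isPair.cosh_arsinh_shDist]

theorem pair_unitTangent (a : Fin 2) :
    pair (coords z) a (z.unitTangent a) =
      ![(reduction z).1 0 - (reduction z).2.2, (reduction z).2.2] a := by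
  fin_cases a
  · exact eq_sub_of_add_eq (by rw [reduction_mx, reduction_snd_snd]; rfl)
  · exact (reduction_snd_snd z).symm

theorem pair_unitNormal (a : Fin 2) :
    pair (coords z) a z.unitNormal =
      ![(reduction z).1 1 - Real.cosh (reduction z).2.1 / Real.sinh (reduction z).2.1 *
          (reduction z).1 2,
        (reduction z).1 2 / Real.sinh (reduction z).2.1] a := by
  have hs := z.isPair.shDist_ne_zero
  rw [sinh_reduction, cosh_reduction, reduction_my, reduction_mz]
  fin_cases a
  · simp only [unitNormal, Fin.zero_eta, Matrix.cons_val_zero]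
    field_simp
    ring
  · exact (mul_div_cancel_left₀ _ hs).symm

variable {z} in
theorem eq_of_R_eq_of_reduction_eq {w : PhaseSpace} (hR : z.R = w.R)
    (h : reduction z = reduction w) : z = w := by
  refine ext_covec (fun a => congrArg _ (congrFun hR a)) fun a v hv hw => ?_
  have unitTangent_eq : z.unitTangent = w.unitTangent := by rw [unitTangent, hR, unitTangent]
  have unitNormal_eq : z.unitNormal = w.unitNormal := by rw [unitNormal, hR, unitNormal]
  rw [covec_eq_pair, covec_eq_pair]
  change pair (coords z) a v = pair (coords w) a v
  rw [eq_add_of_mem_tangentL2 hv]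
  simp only [map_add, map_smul]
  rw [pair_unitTangent, pair_unitNormal, unitTangent_eq, unitNormal_eq, pair_unitTangent,
    pair_unitNormal, h]

end PhaseSpace

/-! ### A section of the reduction map -/

/-- A section of the reduction map, in canonical coordinates: the bodies are at `(0, 0, 1)` and
`(0, -sinh q, cosh q)`, so that their moving frame is the standard frame. -/
def sectionCoords (x : E5) : Model :=
  (fun i => ![![0, 0], ![0, -Real.sinh x.2.1]] i.1 i.2,
    fun i => ![![x.1 1 - Real.cosh x.2.1 / Real.sinh x.2.1 * x.1 2, x.2.2 - x.1 0],
      ![x.1 2 / Real.sinh x.2.1, -(x.2.2 / Real.cosh x.2.1)]] i.1 i.2)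

theorem sectionCoords_mem {x : E5} (hx : x ∈ reducedSet) : sectionCoords x ∈ range coords := by
  rw [range_coords]
  intro h
  have coord_eq : (0 : ℝ) = -Real.sinh x.2.1 := congrFun h 1
  linarith [Real.sinh_pos_iff.2 (show 0 < x.2.1 from hx)]

/-- A section of the reduction map. -/
def reductionSection (x : E5) : PhaseSpace :=
  (isOpenEmbedding_coords.toOpenPartialHomeomorph coords).symm (sectionCoords x)

theorem coords_reductionSection {x : E5} (hx : x ∈ reducedSet) :
    coords (reductionSection x) = sectionCoords x := coords_symm (sectionCoords_mem hx)

theorem reductionSection_R_zero {x : E5} (hx : x ∈ reducedSet) :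
    ((reductionSection x).R 0 : Fin 3 → ℝ) = ![0, 0, 1] := by
  rw [← pos_coords, coords_reductionSection hx]
  simp [pos, sectionCoords, lift]

theorem reductionSection_R_one {x : E5} (hx : x ∈ reducedSet) :
    ((reductionSection x).R 1 : Fin 3 → ℝ) = ![0, -Real.sinh x.2.1, Real.cosh x.2.1] := by
  rw [← pos_coords, coords_reductionSection hx]
  have cosh_eq : Real.sqrt (1 + Real.sinh x.2.1 ^ 2) = Real.cosh x.2.1 := by
    rw [add_comm, ← Real.cosh_sq, Real.sqrt_sq (Real.cosh_pos _).le]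
  simp [pos, sectionCoords, lift, cosh_eq]

section Standard

variable {q : ℝ}

theorem chDist_standard : chDist ![0, 0, 1] ![0, -Real.sinh q, Real.cosh q] = Real.cosh q := by
  simp [chDist, mink_eq]

theorem shDist_standard (hq : 0 < q) :
    shDist ![0, 0, 1] ![0, -Real.sinh q, Real.cosh q] = Real.sinh q := by
  rw [shDist, chDist_standard, Real.cosh_sq, add_sub_cancel_right,
    Real.sqrt_sq (Real.sinh_pos_iff.2 hq).le]

theorem dir₁_standard (hq : 0 < q) :
    dir₁ ![0, 0, 1] ![0, -Real.sinh q, Real.cosh q] = ![0, -1, 0] := by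
  have hs := (Real.sinh_pos_iff.2 hq).ne'
  ext i
  fin_cases i <;> simp [dir₁, chDist_standard, shDist_standard hq, hs]

theorem normal_standard (hq : 0 < q) :
    normal ![0, 0, 1] ![0, -Real.sinh q, Real.cosh q] = ![1, 0, 0] := by
  have hs := (Real.sinh_pos_iff.2 hq).ne'
  ext i
  fin_cases i <;> simp [normal, mcross_eq, shDist_standard hq, hs]

theorem dir₂_standard (hq : 0 < q) :
    dir₂ ![0, 0, 1] ![0, -Real.sinh q, Real.cosh q] = ![0, -Real.cosh q, Real.sinh q] := by
  have hs := (Real.sinh_pos_iff.2 hq).ne'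
  have cosh_mul : Real.cosh q * Real.cosh q - 1 = Real.sinh q * Real.sinh q := by
    linear_combination Real.cosh_sq q
  simp [dir₂, chDist_standard, shDist_standard hq, hs, cosh_mul, mul_comm (Real.cosh q)]

end Standard

theorem pair_sectionCoords_zero (x : E5) (v : Fin 3 → ℝ) :
    pair (sectionCoords x) 0 v =
      (x.1 1 - Real.cosh x.2.1 / Real.sinh x.2.1 * x.1 2) * v 0 + (x.2.2 - x.1 0) * v 1 := rfl

theorem pair_sectionCoords_one (x : E5) (v : Fin 3 → ℝ) :
    pair (sectionCoords x) 1 v =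
      x.1 2 / Real.sinh x.2.1 * v 0 + -(x.2.2 / Real.cosh x.2.1) * v 1 := rfl

theorem reduction_reductionSection {x : E5} (hx : x ∈ reducedSet) :
    reduction (reductionSection x) = x := by
  have hq : 0 < x.2.1 := hx
  have hs := (Real.sinh_pos_iff.2 hq).ne'
  have hc := (Real.cosh_pos x.2.1).ne'
  refine Prod.ext (funext fun k => ?_) (Prod.ext ?_ ?_)
  · fin_cases k
    · refine (reduction_mx _).trans ?_
      rw [reductionSection_R_zero hx, reductionSection_R_one hx, coords_reductionSection hx,
        dir₁_standard hq, dir₂_standard hq, pair_sectionCoords_zero, pair_sectionCoords_one]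
      simp only [Fin.zero_eta, Matrix.cons_val]
      field_simp
      ring
    · refine (reduction_my _).trans ?_
      rw [reductionSection_R_zero hx, reductionSection_R_one hx, coords_reductionSection hx,
        normal_standard hq, chDist_standard, pair_sectionCoords_zero, pair_sectionCoords_one]
      simp only [Fin.mk_one, Matrix.cons_val]
      field_simp
      ring
    · refine (reduction_mz _).trans ?_
      rw [reductionSection_R_zero hx, reductionSection_R_one hx, coords_reductionSection hx,
        normal_standard hq, shDist_standard hq, pair_sectionCoords_one]
      simp only [Fin.reduceFinMk, Matrix.cons_val]
      field_simp
      ring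
  · rw [reduction_snd_fst, reductionSection_R_zero hx, reductionSection_R_one hx,
      shDist_standard hq, Real.arsinh_sinh]
  · rw [reduction_snd_snd, reductionSection_R_zero hx, reductionSection_R_one hx,
      coords_reductionSection hx, dir₂_standard hq, pair_sectionCoords_one]
    simp only [Matrix.cons_val]
    field_simp
    ring

theorem frame_smul_reductionSection (z : PhaseSpace) :
    z.frame • reductionSection (reduction z) = z := by
  have hz := reduction_mem z
  refine PhaseSpace.eq_of_R_eq_of_reduction_eq (funext fun a => Subtype.ext ?_) ?_
  · rw [smul_R]
    fin_cases a
    · exact (congrArg _ (reductionSection_R_zero hz)).trans z.act_frame_left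
    · refine (congrArg _ (reductionSection_R_one hz)).trans ?_
      rw [z.sinh_reduction, z.cosh_reduction]
      exact z.act_frame_right
  · rw [reduction_smul, reduction_reductionSection hz]

theorem contDiffAt_sectionCoords {x : E5} (hx : x ∈ reducedSet) :
    ContDiffAt ℝ ∞ sectionCoords x := by
  have hs : Real.sinh x.2.1 ≠ 0 := (Real.sinh_pos_iff.2 hx).ne'
  have hc : Real.cosh x.2.1 ≠ 0 := (Real.cosh_pos _).ne'
  refine ContDiffAt.prodMk (contDiffAt_pi.2 fun ⟨a, j⟩ => ?_) (contDiffAt_pi.2 fun ⟨a, j⟩ => ?_)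
  · fin_cases a <;> fin_cases j <;> simp only [Fin.zero_eta, Fin.mk_one, Matrix.cons_val] <;>
      fun_prop
  · fin_cases a <;> fin_cases j <;> simp only [Fin.zero_eta, Fin.mk_one, Matrix.cons_val] <;>
      fun_prop (disch := assumption)

/-! ### The Hamiltonian -/

section Kinetic

variable {μ : Fin 2 → ℝ} (z : PhaseSpace)

theorem mul_sub_half_mul_sq_le {m : ℝ} (hm : 0 < m) (x u : ℝ) :
    x * u - m / 2 * u ^ 2 ≤ x ^ 2 / (2 * m) := by
  rw [le_div_iff₀ (by positivity)]
  nlinarith [sq_nonneg (x - m * u)]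

theorem sum_covec_sub_kineticVelocity (v : ∀ a, tangentL2 (z.R a)) :
    ∑ a, z.α a (v a) - kineticVelocity μ v = ∑ a,
      ((pair (coords z) a (z.unitTangent a) * mink (v a) (z.unitTangent a) -
          μ a / 2 * mink (v a) (z.unitTangent a) ^ 2) +
        (pair (coords z) a z.unitNormal * mink (v a) z.unitNormal -
          μ a / 2 * mink (v a) z.unitNormal ^ 2)) := by
  rw [kineticVelocity, Finset.mul_sum, ← Finset.sum_sub_distrib]
  refine Finset.sum_congr rfl fun a _ => ?_
  have decomposition := PhaseSpace.eq_add_of_mem_tangentL2 (v a).2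
  rw [covec_eq_pair]
  generalize mink (v a) (z.unitTangent a) = x at decomposition ⊢
  generalize mink (v a) z.unitNormal = y at decomposition ⊢
  rw [decomposition]
  simp only [map_add, map_smul, smul_eq_mul, mink_add_left, mink_add_right, mink_smul_left,
    mink_smul_right, z.mink_unitTangent_unitTangent, z.mink_unitNormal_unitNormal,
    z.mink_unitTangent_unitNormal, mink_comm z.unitNormal]
  ring

theorem kinetic_eq (hμ : ∀ a, 0 < μ a) :
    kinetic μ z = ∑ a, (pair (coords z) a (z.unitTangent a) ^ 2 / (2 * μ a) +
      pair (coords z) a z.unitNormal ^ 2 / (2 * μ a)) := by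
  refine IsGreatest.csSup_eq ⟨⟨fun a =>
    (pair (coords z) a (z.unitTangent a) / μ a) • ⟨z.unitTangent a, z.unitTangent_mem a⟩ +
      (pair (coords z) a z.unitNormal / μ a) • ⟨z.unitNormal, z.unitNormal_mem a⟩, ?_⟩, ?_⟩
  · refine (sum_covec_sub_kineticVelocity z _).trans (Finset.sum_congr rfl fun a _ => ?_)
    have := (hμ a).ne'
    simp only [Submodule.coe_add, Submodule.coe_smul, mink_add_left, mink_smul_left,
      z.mink_unitTangent_unitTangent, z.mink_unitNormal_unitNormal, z.mink_unitTangent_unitNormal,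
      mink_comm z.unitNormal]
    field_simp
    ring
  · rintro _ ⟨v, rfl⟩
    exact (sum_covec_sub_kineticVelocity z v).trans_le (Finset.sum_le_sum fun a _ =>
      add_le_add (mul_sub_half_mul_sq_le (hμ a) _ _) (mul_sub_half_mul_sq_le (hμ a) _ _))

end Kinetic

theorem dotProduct_A_mulVec (μ q : ℝ) (m : Fin 3 → ℝ) :
    m ⬝ᵥ (A μ q *ᵥ m) = m 0 ^ 2 + m 1 ^ 2 - 2 * (Real.cosh q / Real.sinh q) * m 1 * m 2 +
      (μ + Real.cosh q ^ 2) / Real.sinh q ^ 2 * m 2 ^ 2 := by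
  simp only [A, dotProduct, Matrix.mulVec, Fin.sum_univ_three, Matrix.of_apply, Matrix.cons_val]
  ring

theorem hamiltonian_eq {μ : Fin 2 → ℝ} (hμ : ∀ a, 0 < μ a) (U : ℝ → ℝ) (z : PhaseSpace) :
    hamiltonian μ U z = reducedHamiltonian (μ 0) (μ 1) U (reduction z) := by
  have hs := (Real.sinh_pos_iff.2 (reduction_mem z)).ne'
  have h₀ := (hμ 0).ne'
  have h₁ := (hμ 1).ne'
  rw [hamiltonian, reducedHamiltonian, kinetic_eq z hμ, ← qCoord_reduction, dotProduct_A_mulVec]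
  simp only [z.pair_unitTangent, z.pair_unitNormal, Fin.sum_univ_two, Matrix.cons_val]
  refine congrArg₂ _ ?_ rfl
  generalize reduction z = x at hs ⊢
  field_simp
  ring

theorem differentiableAt_reducedHamiltonian (μ₁ μ₂ : ℝ) {U : ℝ → ℝ}
    (hU : DifferentiableOn ℝ U (Ioi 0)) {x : E5} (hx : x ∈ reducedSet) :
    DifferentiableAt ℝ (reducedHamiltonian μ₁ μ₂ U) x := by
  have hs := (Real.sinh_pos_iff.2 hx).ne'
  have hs2 := pow_ne_zero 2 hs
  have potential : DifferentiableAt ℝ (fun x : E5 => U x.2.1) x :=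
    (hU.differentiableAt (Ioi_mem_nhds hx)).comp x (by fun_prop)
  refine DifferentiableAt.add ?_ potential
  simp only [dotProduct_A_mulVec]
  fun_prop (disch := assumption)

/-! ### The reduced space -/

theorem continuous_reduction : Continuous reduction :=
  continuous_iff_continuousAt.2 fun z => (contDiffAt_reductionCoords z).continuousAt.comp
    isOpenEmbedding_coords.continuous.continuousAt

theorem continuousOn_reductionSection : ContinuousOn reductionSection reducedSet :=
  isOpenEmbedding_coords.isInducing.continuousOn_iff.2 <| ContinuousOn.congr
    (fun _ hx => (contDiffAt_sectionCoords hx).continuousAt.continuousWithinAt)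
    fun _ hx => coords_reductionSection hx

/-- The reduction map as an isomorphism of the reduced space with `ℝ³ × (0, ∞) × ℝ`. -/
def reductionHomeomorph : MulAction.orbitRel.Quotient SO21 PhaseSpace ≃ₜ reducedSet where
  toFun := Quotient.lift (fun z => (⟨reduction z, reduction_mem z⟩ : reducedSet)) <| by
    rintro _ w ⟨g, rfl⟩
    exact Subtype.ext (reduction_smul g w)
  invFun x := Quotient.mk _ (reductionSection x)
  left_inv := Quotient.ind fun z =>
    (Quotient.sound ⟨z.frame, frame_smul_reductionSection z⟩ :
      Quotient.mk (MulAction.orbitRel SO21 PhaseSpace) z = _).symm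
  right_inv x := Subtype.ext (reduction_reductionSection x.2)
  continuous_toFun := (continuous_reduction.subtype_mk _).quotient_lift _
  continuous_invFun := continuous_quotient_mk'.comp
    (continuousOn_iff_continuous_domRestrict.1 continuousOn_reductionSection)

theorem contMDiff_iff_coords {F : Type*} [NormedAddCommGroup F] [NormedSpace ℝ F]
    {f : PhaseSpace → F} : ContMDiff 𝓘(ℝ, Model) 𝓘(ℝ, F) ∞ f ↔ ∀ z, ContDiffAt ℝ ∞
      (f ∘ (isOpenEmbedding_coords.toOpenPartialHomeomorph coords).symm) (coords z) := by
  have factor : f = (f ∘ (isOpenEmbedding_coords.toOpenPartialHomeomorph coords).symm) ∘ coords :=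
    funext fun z => by simp only [Function.comp_apply, symm_coords]
  refine forall_congr' fun z => ?_
  rw [contMDiffAt_iff]
  simp only [mfld_simps, contDiffWithinAt_univ]
  refine ⟨fun h => h.2, fun h => ⟨?_, h⟩⟩
  rw [factor]
  exact h.continuousAt.comp isOpenEmbedding_coords.continuous.continuousAt

theorem contMDiff_reduction : ContMDiff 𝓘(ℝ, Model) 𝓘(ℝ, E5) ∞ reduction :=
  contMDiff_iff_coords.2 fun z => (contDiffAt_reductionCoords z).congr_of_eventuallyEq
    (reduction_comp_symm_eventuallyEq z)

theorem mfderiv_reduction (z : PhaseSpace) :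
    mfderiv 𝓘(ℝ, Model) 𝓘(ℝ, E5) reduction z = fderiv ℝ reductionCoords (coords z) := by
  refine (contMDiff_reduction.mdifferentiable (by simp) z).mfderiv.trans ?_
  simp only [writtenInExtChartAt, mfld_simps, fderivWithin_univ]
  exact (reduction_comp_symm_eventuallyEq z).fderiv_eq

theorem contDiffOn_iff_comp_reduction (f : E5 → ℝ) : ContDiffOn ℝ ∞ f reducedSet ↔
    ContMDiff 𝓘(ℝ, Model) 𝓘(ℝ, ℝ) ∞ (f ∘ reduction) := by
  rw [contMDiff_iff_coords]
  constructor
  · intro hf z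
    have hfz := hf.contDiffAt (isOpen_reducedSet.mem_nhds (reduction_mem z))
    exact (ContDiffAt.comp (coords z) (g := f) hfz
      (contDiffAt_reductionCoords z)).congr_of_eventuallyEq
        ((reduction_comp_symm_eventuallyEq z).fun_comp f)
  · intro hf x hx
    have hfx := hf (reductionSection x)
    rw [coords_reductionSection hx] at hfx
    refine ((hfx.comp x (contDiffAt_sectionCoords hx)).congr_of_eventuallyEq ?_).contDiffWithinAt
    filter_upwards [isOpen_reducedSet.mem_nhds hx] with w hw
    exact congrArg f (reduction_reductionSection hw).symm

/-! ### The reduction map is a submersion -/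

theorem exists_pair_eq_mink (z : PhaseSpace) (u : Fin 2 → Fin 3 → ℝ) :
    ∃ w : PhaseSpace, w.R = z.R ∧
      ∀ a, ∀ v ∈ tangentL2 (z.R a), pair (coords w) a v = mink (u a) v := by
  let w : PhaseSpace :=
    ⟨z.R, z.ne, fun a => (minkCLM (u a)).toLinearMap ∘ₗ (tangentL2 (z.R a)).subtype⟩
  exact ⟨w, rfl, fun a v hv =>
    (covec_eq_pair w a ⟨v, hv⟩).symm.trans (minkCLM_apply (u a) v)⟩

theorem exists_reduction_eq (z : PhaseSpace) (m : Fin 3 → ℝ) (p : ℝ) :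
    ∃ w : PhaseSpace, w.R = z.R ∧ reduction w = (m, (reduction z).2.1, p) := by
  have hs := z.isPair.shDist_ne_zero
  let c := chDist (z.R 0 : Fin 3 → ℝ) (z.R 1)
  let s := shDist (z.R 0 : Fin 3 → ℝ) (z.R 1)
  obtain ⟨w, hR, hw⟩ := exists_pair_eq_mink z fun a =>
    ![m 0 - p, p] a • z.unitTangent a + ![m 1 - c / s * m 2, m 2 / s] a • z.unitNormal
  have pair_unitTangent (a : Fin 2) :
      pair (coords w) a (z.unitTangent a) = ![m 0 - p, p] a := by
    rw [hw a _ (z.unitTangent_mem a), mink_add_left, mink_smul_left, mink_smul_left,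
      z.mink_unitTangent_unitTangent, mink_comm z.unitNormal, z.mink_unitTangent_unitNormal]
    ring
  have pair_unitNormal (a : Fin 2) :
      pair (coords w) a z.unitNormal = ![m 1 - c / s * m 2, m 2 / s] a := by
    rw [hw a _ (z.unitNormal_mem a), mink_add_left, mink_smul_left, mink_smul_left,
      z.mink_unitNormal_unitNormal, z.mink_unitTangent_unitNormal]
    ring
  refine ⟨w, hR, Prod.ext (funext fun k => ?_) (Prod.ext ?_ ?_)⟩
  · fin_cases k
    · refine (reduction_mx w).trans ?_
      rw [hR]
      exact (congrArg₂ _ (pair_unitTangent 0) (pair_unitTangent 1)).trans (sub_add_cancel _ _)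
    · refine (reduction_my w).trans ?_
      rw [hR]
      refine (congrArg₂ (fun x y => x + c * y) (pair_unitNormal 0) (pair_unitNormal 1)).trans ?_
      simp only [Matrix.cons_val, Fin.mk_one]
      ring
    · refine (reduction_mz w).trans ?_
      rw [hR]
      exact (congrArg (s * ·) (pair_unitNormal 1)).trans (mul_div_cancel₀ _ hs)
  · rw [reduction_snd_fst, reduction_snd_fst, hR]
  · rw [reduction_snd_snd, hR]
    exact pair_unitTangent 1

theorem fderiv_reductionCoords_coords_snd {z w : PhaseSpace} (hR : w.R = z.R) :
    fderiv ℝ reductionCoords (coords z) (0, (coords w).2) =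
      ((reduction w).1, 0, (reduction w).2.2) := by
  have fst_eq : (coords z).1 = (coords w).1 := by
    funext i
    change (z.R i.1 : Fin 3 → ℝ) i.2.castSucc = (w.R i.1 : Fin 3 → ℝ) i.2.castSucc
    rw [hR]
  rw [fderiv_reductionCoords_momentum, ← hR, fst_eq, reduction_snd_snd]
  exact Prod.ext (funext fun k => (reduction_fst_apply w k).symm) rfl

theorem surjective_fderiv_reductionCoords (z : PhaseSpace) :
    Function.Surjective (fderiv ℝ reductionCoords (coords z)) := by
  intro x
  have fderiv_velocityDir := (differentiableAt_reductionCoords z).hasFDerivAt.hasLineDerivAt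
    (velocityDir (velocity z 0 1)) |>.unique (hasDerivAt_reductionCoords_velocityDir z 0 1)
  set V := velocityDir (velocity z 0 1)
  set y := fderiv ℝ reductionCoords (coords z) V
  have y_q : y.2.1 = 1 := congrArg (fun x : E5 => x.2.1) fderiv_velocityDir
  obtain ⟨w, hR, hw⟩ := exists_reduction_eq z (x - x.2.1 • y).1 (x - x.2.1 • y).2.2
  refine ⟨(0, (coords w).2) + x.2.1 • V, ?_⟩
  rw [map_add, map_smul, fderiv_reductionCoords_coords_snd hR, hw]
  refine eq_sub_iff_add_eq.1 (Prod.ext rfl (Prod.ext ?_ rfl))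
  change 0 = x.2.1 - x.2.1 * y.2.1
  rw [y_q, mul_one, sub_self]

end TwoBodyL2

end

open TwoBodyL2 in
/-- Reduction of the two-body problem on the Lobachevsky plane. -/
theorem mainTheorem8 :
    -- the bracket on `ℝ³ × (0, ∞) × ℝ` is a Poisson bracket with the stated relations
    IsPoissonBracketOn reducedSet reducedBracket ∧
    (∀ x ∈ reducedSet,
      reducedBracket (mCoord 0) (mCoord 1) x = mCoord 2 x ∧
      reducedBracket (mCoord 1) (mCoord 2) x = -mCoord 0 x ∧
      reducedBracket (mCoord 2) (mCoord 0) x = -mCoord 1 x ∧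
      reducedBracket qCoord pCoord x = 1 ∧
      ∀ a, reducedBracket (mCoord a) qCoord x = 0 ∧ reducedBracket (mCoord a) pCoord x = 0) ∧
    -- it is the product of the Lie-Poisson bracket of `so(2,1)*` and the canonical bracket
    (∃ e : (Fin 3 → ℝ) ≃ₗ[ℝ] so21,
      (∀ w, (e w : Matrix (Fin 3) (Fin 3) ℝ) = tilde w) ∧
      ∀ (f g : E5 → ℝ), ∀ x ∈ reducedSet,
        reducedBracket f g x =
          -(x.1 ⬝ᵥ e.symm ⁅e (gradm f x), e (gradm g x)⁆)
            + (dq f x * dp g x - dp f x * dq g x)) ∧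
    -- the isomorphism of Poisson manifolds and the reduced dynamics
    (∃ Φ : MulAction.orbitRel.Quotient SO21 PhaseSpace ≃ₜ reducedSet,
      let J : PhaseSpace → E5 := fun z => (Φ (Quotient.mk _ z) : E5)
      (ContMDiff 𝓘(ℝ, Model) 𝓘(ℝ, E5) ∞ J ∧
        ∀ z, Function.Surjective (mfderiv 𝓘(ℝ, Model) 𝓘(ℝ, E5) J z)) ∧
      (∀ f : E5 → ℝ, ContDiffOn ℝ ∞ f reducedSet ↔
        ContMDiff 𝓘(ℝ, Model) 𝓘(ℝ, ℝ) ∞ (f ∘ J)) ∧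
      (∀ f g : E5 → ℝ, ContDiffOn ℝ ∞ f reducedSet → ContDiffOn ℝ ∞ g reducedSet →
        ∀ z, canonicalBracket (f ∘ J) (g ∘ J) z = reducedBracket f g (J z)) ∧
      (∀ z, qCoord (J z) = riemDist (z.R 0) (z.R 1)) ∧
      ∀ (μ : Fin 2 → ℝ) (U : ℝ → ℝ), (∀ a, 0 < μ a) → DifferentiableOn ℝ U (Set.Ioi 0) →
        (∀ z, hamiltonian μ U z = reducedHamiltonian (μ 0) (μ 1) U (J z)) ∧
        ∀ (c : ℝ → PhaseSpace) (t : ℝ), HamiltonEqAt (hamiltonian μ U) c t →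
          HasDerivAt (J ∘ c)
            (reducedVectorField (reducedHamiltonian (μ 0) (μ 1) U) (J (c t))) t) ∧
    -- the Casimir function, and its uniqueness up to functional dependence where `m ≠ 0`
    IsCasimirOn reducedSet reducedBracket casimir ∧
    (∀ F, IsCasimirOn reducedSet reducedBracket F → ∀ x ∈ reducedSet, x.1 ≠ 0 →
      ∃ l : ℝ, fderiv ℝ F x = l • fderiv ℝ casimir x) := by
  refine ⟨isPoissonBracketOn_reducedBracket, fun x _ => reducedBracket_coord x,
    ⟨tildeEquiv, fun _ => rfl, fun f g x _ => reducedBracket_eq_liePoisson f g x⟩,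
    ⟨reductionHomeomorph, ⟨contMDiff_reduction, fun z => ?_⟩, contDiffOn_iff_comp_reduction,
      fun f g hf hg z => ?_, qCoord_reduction, fun μ U hμ hU =>
        ⟨hamiltonian_eq hμ U, fun c t hc => ?_⟩⟩,
    isCasimirOn_casimir, fun F hF x hx hm => hF.exists_fderiv_eq_smul hx hm⟩
  · change Function.Surjective (mfderiv 𝓘(ℝ, Model) 𝓘(ℝ, E5) reduction z)
    rw [mfderiv_reduction]
    exact surjective_fderiv_reductionCoords z
  · exact canonicalBracket_comp_reduction
      (differentiableAt_of_contDiffOn_reducedSet hf (reduction_mem z))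
      (differentiableAt_of_contDiffOn_reducedSet hg (reduction_mem z))
  · have e : hamiltonian μ U = reducedHamiltonian (μ 0) (μ 1) U ∘ reduction :=
      funext (hamiltonian_eq hμ U)
    rw [e] at hc
    exact hasDerivAt_reduction_comp
      (differentiableAt_reducedHamiltonian _ _ hU (reduction_mem _)) hc
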